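/- Let $\Omega\subset\mathbb R^{2n}$ be a bounded domain (nonempty, open and connected). For a vector field $\vec G=(g_1,g_2,\dots,g_{2n})$ put $\vec G^{*}=(g_2,-g_1,g_4,-g_3,\dots,g_{2n},-g_{2n-1})$. Let $\vec F$ be a vector field on $\Omega$ all of whose components belong to $W^{1,2}(\Omega)$, and suppose that $\operatorname{div}\vec F^{*}>0$ a.e. in $\Omega$ (the divergence is taken with weak derivatives). For a function $u$ on $\Omega$ with weak gradient $\nabla u$ let $S(u)=\{x\in\Omega:\nabla u(x)+\vec F(x)=0\}$, and let $$N(u)=\frac{\nabla u+\vec F}{|\nabla u+\vec F|}\qquad\text{on }\Omega\setminus S(u).$$ Suppose that $u,v\in W^{1,2}(\Omega)$ satisfy the following two conditions. (1) $\operatorname{div}N(u)\ge\operatorname{div}N(v)$ in $\Omega$ in the weak sense, that is, for every $\varphi\in W^{1,1}_0(\Omega)$ with $\varphi\ge 0$ (a.e.), $$-\int_{S(u)}|\nabla\varphi|+\int_{\Omega\setminus S(u)}N(u)\cdot\nabla\varphi\ \le\ \int_{S(v)}|\nabla\varphi|+\int_{\Omega\setminus S(v)}N(v)\cdot\nabla\varphi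 .$$ (2) $u\le v$ on $\partial\Omega$, meaning that $(u-v)^{+}=\max(u-v,0)\in W^{1,1}_0(\Omega)$, where $W^{1,1}_0(\Omega)$ is the closure of $C_0^\infty(\Omega)$ in $W^{1,1}(\Omega)$. Then $u\le v$ a.e. in $\Omega$. -/

import Mathlib

open MeasureTheory Filter Topology
open scoped ContDiff ENNReal

noncomputable section

namespace HeisenbergGraph

/-- Real-valued test functions: the space `C_0^∞(Ω)` of smooth functions with compact support
contained in the open set `Ω`. -/
def IsTestFunction {m : ℕ} (Ω : Set (EuclideanSpace ℝ (Fin m)))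
    (φ : EuclideanSpace ℝ (Fin m) → ℝ) : Prop :=
  ContDiff ℝ ∞ φ ∧ HasCompactSupport φ ∧ tsupport φ ⊆ Ω

/-- `g` is a weak (distributional) gradient of `u` in `Ω`: both are locally integrable in `Ω` and
`∫_Ω u ∂_i φ = - ∫_Ω g_i φ` for every test function `φ` and every coordinate `i`. -/
def IsWeakGrad {m : ℕ} (Ω : Set (EuclideanSpace ℝ (Fin m)))
    (u : EuclideanSpace ℝ (Fin m) → ℝ)
    (g : EuclideanSpace ℝ (Fin m) → EuclideanSpace ℝ (Fin m)) : Prop :=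
  LocallyIntegrableOn u Ω volume ∧ LocallyIntegrableOn g Ω volume ∧
    ∀ φ : EuclideanSpace ℝ (Fin m) → ℝ, IsTestFunction Ω φ → ∀ i : Fin m,
      ∫ x in Ω, u x * fderiv ℝ φ x (EuclideanSpace.single i 1) = - ∫ x in Ω, g x i * φ x

open Classical in
/-- The weak gradient `∇u` of `u` in `Ω` (a chosen representative of the almost everywhere class;
the value is `0` if `u` has no weak gradient). -/
def weakGrad {m : ℕ} (Ω : Set (EuclideanSpace ℝ (Fin m)))
    (u : EuclideanSpace ℝ (Fin m) → ℝ) :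
    EuclideanSpace ℝ (Fin m) → EuclideanSpace ℝ (Fin m) :=
  if h : ∃ g, IsWeakGrad Ω u g then h.choose else 0

/-- The Sobolev space `W^{1,p}(Ω)`. -/
def MemW1p {m : ℕ} (p : ℝ≥0∞) (Ω : Set (EuclideanSpace ℝ (Fin m)))
    (u : EuclideanSpace ℝ (Fin m) → ℝ) : Prop :=
  MemLp u p (volume.restrict Ω) ∧
    ∃ g, IsWeakGrad Ω u g ∧ MemLp g p (volume.restrict Ω)

/-- The space `W_0^{1,p}(Ω)`: the closure of `C_0^∞(Ω)` in `W^{1,p}(Ω)`. -/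
def MemW1p0 {m : ℕ} (p : ℝ≥0∞) (Ω : Set (EuclideanSpace ℝ (Fin m)))
    (u : EuclideanSpace ℝ (Fin m) → ℝ) : Prop :=
  MemW1p p Ω u ∧
    ∃ φ : ℕ → EuclideanSpace ℝ (Fin m) → ℝ, (∀ k, IsTestFunction Ω (φ k)) ∧
      Tendsto (fun k => eLpNorm (fun x => φ k x - u x) p (volume.restrict Ω)) atTop (𝓝 0) ∧
      Tendsto (fun k => eLpNorm (fun x => gradient (φ k) x - weakGrad Ω u x) p
        (volume.restrict Ω)) atTop (𝓝 0)

/-- A vector field belongs to `W^{1,p}(Ω)` if all its components do. -/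
def VecMemW1p {m : ℕ} (p : ℝ≥0∞) (Ω : Set (EuclideanSpace ℝ (Fin m)))
    (F : EuclideanSpace ℝ (Fin m) → EuclideanSpace ℝ (Fin m)) : Prop :=
  ∀ i : Fin m, MemW1p p Ω (fun x => F x i)

/-- The weak divergence `∑_i ∂_i G_i` of a vector field in `Ω`. -/
def weakDiv {m : ℕ} (Ω : Set (EuclideanSpace ℝ (Fin m)))
    (G : EuclideanSpace ℝ (Fin m) → EuclideanSpace ℝ (Fin m))
    (x : EuclideanSpace ℝ (Fin m)) : ℝ :=
  ∑ i : Fin m, weakGrad Ω (fun y => G y i) x i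

/-- `(g₁, g₂, …, g₂ₙ)^* = (g₂, -g₁, g₄, -g₃, …, g₂ₙ, -g₂ₙ₋₁)`; coordinates are numbered from `0`
here, so that the pairs are `(2k, 2k+1)`. -/
def starVec {n : ℕ} (g : EuclideanSpace ℝ (Fin (2 * n))) : EuclideanSpace ℝ (Fin (2 * n)) :=
  WithLp.toLp 2 fun i =>
    if h : i.1 % 2 = 0 then g ⟨i.1 + 1, by omega⟩ else - g ⟨i.1 - 1, by omega⟩

/-- The singular set `S(u)`: the points of `Ω` where `∇u + F = 0`. -/
def singSet {m : ℕ} (Ω : Set (EuclideanSpace ℝ (Fin m)))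
    (F : EuclideanSpace ℝ (Fin m) → EuclideanSpace ℝ (Fin m))
    (u : EuclideanSpace ℝ (Fin m) → ℝ) : Set (EuclideanSpace ℝ (Fin m)) :=
  {x | x ∈ Ω ∧ weakGrad Ω u x + F x = 0}

/-- `N(u) = (∇u + F) / |∇u + F|`, used off the singular set only. -/
def normalN {m : ℕ} (Ω : Set (EuclideanSpace ℝ (Fin m)))
    (F : EuclideanSpace ℝ (Fin m) → EuclideanSpace ℝ (Fin m))
    (u : EuclideanSpace ℝ (Fin m) → ℝ) (x : EuclideanSpace ℝ (Fin m)) :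
    EuclideanSpace ℝ (Fin m) :=
  ‖weakGrad Ω u x + F x‖⁻¹ • (weakGrad Ω u x + F x)

/-- `div N(u) ≥ div N(v)` in `Ω` in the weak sense. -/
def DivNGe {m : ℕ} (Ω : Set (EuclideanSpace ℝ (Fin m)))
    (F : EuclideanSpace ℝ (Fin m) → EuclideanSpace ℝ (Fin m))
    (u v : EuclideanSpace ℝ (Fin m) → ℝ) : Prop :=
  ∀ φ : EuclideanSpace ℝ (Fin m) → ℝ, MemW1p0 1 Ω φ →
    (∀ᵐ x ∂(volume.restrict Ω), 0 ≤ φ x) →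
    - (∫ x in singSet Ω F u, ‖weakGrad Ω φ x‖)
        + ∫ x in Ω \ singSet Ω F u, inner ℝ (normalN Ω F u x) (weakGrad Ω φ x)
      ≤ (∫ x in singSet Ω F v, ‖weakGrad Ω φ x‖)
        + ∫ x in Ω \ singSet Ω F v, inner ℝ (normalN Ω F v x) (weakGrad Ω φ x)

/-- `u ≤ v` on `∂Ω` in the Sobolev sense: `(u - v)^+ ∈ W_0^{1,1}(Ω)`. -/
def LeOnBoundary {m : ℕ} (Ω : Set (EuclideanSpace ℝ (Fin m)))
    (u v : EuclideanSpace ℝ (Fin m) → ℝ) : Prop :=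
  MemW1p0 1 Ω (fun x => max (u x - v x) 0)

end HeisenbergGraph

end

/-! Write w = (u - v)⁺, a = ∇u + F, b = ∇v + F. Where u > v one has ∇w = a - b, and off the singular
sets (N(u) - N(v)) · (a - b) = (1/|a| + 1/|b|)(|a||b| - a · b) ≥ 0. On the singular sets the terms
±|∇w| agree exactly with their counterparts. Testing the weak inequality with φ = w gives the
opposite sign for the integral, so equality holds a.e. and |b| a = |a| b on {u > v}
(`ae_parallel_of_divNGe`). Hence a - b is a multiple of b where b ≠ 0, and b · b* = 0 yields ∇w ·
(∇v + F)* = 0 a.e.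

Multiply this by 2 f arctan'(w), where f = arctan w. The F part is ∇(f²) · F*, whose integral is -∫
f² div F* because f vanishes on the boundary (`IsBoundedTestLimit.integral_eq_zero`). The v part is
2 f ∇f · (∇v)*, whose integral vanishes since (∇v)* is divergence free; for v merely in W^{1,2} this
is the symmetry of mixed derivatives in weak form (`IsBoundedTestLimit.integral_partial_comm`).
Therefore ∫ f² div F* = 0, and div F* > 0 forces f = 0, that is u ≤ v.

Boundary regularity is never needed: `IsBoundedTestLimit` records that f is a bounded limit of test
functions, so products with f extend by zero to weakly differentiable functions on the whole space.
-/

open scoped Convolution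

namespace HeisenbergGraph

/-! ### Mollification and its convergence in L^p and almost everywhere. -/

section Mollification

set_option linter.unusedSectionVars false

variable {E : Type*} [NormedAddCommGroup E] [NormedSpace ℝ E] [FiniteDimensional ℝ E]
  [MeasurableSpace E] [BorelSpace E] {μ : Measure E} [μ.IsAddHaarMeasure]

/-- The mollification of `f` by the normalized bump function `ρ`. -/
noncomputable def mollify (μ : Measure E) (ρ : ContDiffBump (0 : E)) (f : E → ℝ) : E → ℝ :=
  ρ.normed μ ⋆[ContinuousLinearMap.lsmul ℝ ℝ, μ] f

lemma mollify_apply (ρ : ContDiffBump (0 : E)) (f : E → ℝ) (x : E) :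
    mollify μ ρ f x = ∫ t, ρ.normed μ t * f (x - t) ∂μ := rfl

lemma mollify_congr_ae {ρ : ContDiffBump (0 : E)} {f g : E → ℝ} (h : f =ᵐ[μ] g) :
    mollify μ ρ f = mollify μ ρ g := convolution_congr _ (Eventually.of_forall fun _ => rfl) h

lemma mollify_integrable (ρ : ContDiffBump (0 : E)) {f : E → ℝ} (hf : LocallyIntegrable f μ)
    (x : E) : Integrable (fun t => ρ.normed μ t * f (x - t)) μ :=
  HasCompactSupport.convolutionExists_left (ContinuousLinearMap.lsmul ℝ ℝ)
    ρ.hasCompactSupport_normed ρ.continuous_normed hf x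

lemma contDiff_mollify (ρ : ContDiffBump (0 : E)) {f : E → ℝ} (hf : LocallyIntegrable f μ) :
    ContDiff ℝ (∞ : ℕ∞ω) (mollify μ ρ f) :=
  HasCompactSupport.contDiff_convolution_left _ ρ.hasCompactSupport_normed ρ.contDiff_normed hf

/-- Translations preserve the measure and depend continuously on t, so composition with them is
continuous in L^p for finite p. -/
lemma tendsto_eLpNorm_translate {p : ℝ≥0∞} (hp1 : 1 ≤ p) (hp : p ≠ ⊤) {f : E → ℝ}
    (hf : MemLp f p μ) :
    Tendsto (fun t : E => eLpNorm (fun x => f (x - t) - f x) p μ) (𝓝 0) (𝓝 0) := by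
  have : Fact (1 ≤ p) := ⟨hp1⟩
  let G : C(E, C(E, E)) :=
    ContinuousMap.curry ⟨fun q : E × E => q.2 - q.1, continuous_snd.sub continuous_fst⟩
  have hG : ∀ t, MeasurePreserving (G t) μ μ := fun t => measurePreserving_sub_right μ t
  have key := Filter.Tendsto.compMeasurePreservingLp (μ := μ) (ν := μ) (l := 𝓝 (0 : E))
    (f := fun _ => hf.toLp f) (f₀ := hf.toLp f) tendsto_const_nhds (G.continuous.tendsto 0)
    hG (hG 0) hp
  rw [Lp.tendsto_Lp_iff_tendsto_eLpNorm'] at key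
  refine key.congr fun t => eLpNorm_congr_ae ?_
  simp only [Lp.toLp_compMeasurePreserving]
  filter_upwards [MemLp.coeFn_toLp (hf.comp_measurePreserving (hG t)),
    MemLp.coeFn_toLp (hf.comp_measurePreserving (hG 0))] with x h1 h2
  simp only [Pi.sub_apply, h1, h2]
  simp [G]

/-- The mollification error is an average of f(x - t) - f(x) over the probability measure with
density ρ. Jensen's inequality and Tonelli's theorem bound its L^p norm by the worst translation
error on the support of ρ. -/
lemma eLpNorm_mollify_sub_le {p : ℝ≥0∞} (hp1 : 1 ≤ p) (hp : p ≠ ⊤) {f : E → ℝ}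
    (hf : MemLp f p μ) (ρ : ContDiffBump (0 : E)) {ε : ℝ≥0∞}
    (hε : ∀ t ∈ Metric.ball (0 : E) ρ.rOut, eLpNorm (fun x => f (x - t) - f x) p μ ≤ ε) :
    eLpNorm (fun x => mollify μ ρ f x - f x) p μ ≤ ε := by
  -- A genuinely measurable representative makes (x, t) ↦ f(x - t) - f(x) jointly measurable, as
  -- Tonelli's theorem requires.
  wlog hmeas : StronglyMeasurable f generalizing f
  · obtain ⟨g, hg, hfg⟩ := hf.1
    have := this (f := g) ((memLp_congr_ae hfg).1 hf) (fun t ht => ?_) hg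
    · rw [mollify_congr_ae hfg]
      refine le_trans (le_of_eq (eLpNorm_congr_ae ?_)) this
      filter_upwards [hfg] with x hx
      rw [hx]
    · refine le_trans (le_of_eq (eLpNorm_congr_ae ?_)) (hε t ht)
      filter_upwards [hfg, (measurePreserving_sub_right μ t).quasiMeasurePreserving.ae_eq_comp hfg]
        with x hx hx2
      simp only [Function.comp_apply] at hx2
      rw [hx, hx2]
  have hp0 : p ≠ 0 := (zero_lt_one.trans_le hp1).ne'
  have hr : 0 < p.toReal := ENNReal.toReal_pos hp0 hp
  have hloc : LocallyIntegrable f μ := hf.locallyIntegrable hp1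
  let d : E → ℝ≥0∞ := fun t => ENNReal.ofReal (ρ.normed μ t)
  have hd : Measurable d := ρ.continuous_normed.measurable.ennreal_ofReal
  let ν := μ.withDensity d
  have hν : IsProbabilityMeasure ν := by
    constructor
    rw [withDensity_apply _ MeasurableSet.univ, Measure.restrict_univ,
      ← ofReal_integral_eq_lintegral_ofReal ρ.integrable_normed
        (Eventually.of_forall ρ.nonneg_normed), ρ.integral_normed, ENNReal.ofReal_one]
  have hm2 : Measurable (fun q : E × E => f (q.1 - q.2) - f q.1) :=
    (hmeas.measurable.comp (measurable_fst.sub measurable_snd)).sub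
      (hmeas.measurable.comp measurable_fst)
  have hpt : ∀ x, ‖mollify μ ρ f x - f x‖ₑ ^ p.toReal
      ≤ ∫⁻ t, ‖f (x - t) - f x‖ₑ ^ p.toReal ∂ν := by
    intro x
    have hmx : Measurable (fun t => f (x - t) - f x) := hm2.comp measurable_prodMk_left
    have h1 : mollify μ ρ f x - f x = ∫ t, ρ.normed μ t * (f (x - t) - f x) ∂μ := by
      have h2 := ρ.integral_normed_smul μ (f x)
      simp only [smul_eq_mul] at h2
      rw [mollify_apply]
      conv_lhs => rw [← h2]
      rw [← integral_sub (mollify_integrable ρ hloc x) (ρ.integrable_normed.mul_const _)]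
      simp only [mul_sub]
    have h3 : ‖mollify μ ρ f x - f x‖ₑ ≤ eLpNorm (fun t => f (x - t) - f x) 1 ν := by
      rw [h1, eLpNorm_one_eq_lintegral_enorm,
        lintegral_withDensity_eq_lintegral_mul _ hd hmx.enorm]
      refine (enorm_integral_le_lintegral_enorm _).trans (lintegral_mono fun t => ?_)
      rw [enorm_mul, Real.enorm_of_nonneg (ρ.nonneg_normed t)]
      rfl
    -- Jensen's inequality, in the form that L^p norms over a probability measure increase with p.
    have h4 := h3.trans (eLpNorm_le_eLpNorm_of_exponent_le hp1 hmx.aestronglyMeasurable)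
    rw [eLpNorm_eq_lintegral_rpow_enorm_toReal hp0 hp] at h4
    calc _ ≤ _ := ENNReal.rpow_le_rpow h4 hr.le
      _ = _ := by rw [← ENNReal.rpow_mul, one_div, inv_mul_cancel₀ hr.ne', ENNReal.rpow_one]
  have hfin : ∫⁻ x, ‖mollify μ ρ f x - f x‖ₑ ^ p.toReal ∂μ ≤ ε ^ p.toReal := by
    calc _ ≤ ∫⁻ x, ∫⁻ t, ‖f (x - t) - f x‖ₑ ^ p.toReal ∂ν ∂μ := lintegral_mono hpt
      _ = ∫⁻ t, ∫⁻ x, ‖f (x - t) - f x‖ₑ ^ p.toReal ∂μ ∂ν :=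
        lintegral_lintegral_swap (hm2.enorm.pow_const _).aemeasurable
      _ ≤ ∫⁻ t, ε ^ p.toReal ∂ν := by
        refine lintegral_mono_ae ?_
        refine (ae_withDensity_iff hd).2 (Eventually.of_forall fun t ht => ?_)
        have htb : t ∈ Metric.ball (0 : E) ρ.rOut := by
          rw [← ρ.support_normed_eq (μ := μ)]
          intro h
          simp [d, h] at ht
        have := hε t htb
        rw [eLpNorm_eq_lintegral_rpow_enorm_toReal hp0 hp] at this
        calc _ = ((∫⁻ x, ‖f (x - t) - f x‖ₑ ^ p.toReal ∂μ) ^ (1 / p.toReal)) ^ p.toReal := by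
              rw [← ENNReal.rpow_mul, one_div, inv_mul_cancel₀ hr.ne', ENNReal.rpow_one]
          _ ≤ _ := ENNReal.rpow_le_rpow this hr.le
      _ = _ := by simp
  rw [eLpNorm_eq_lintegral_rpow_enorm_toReal hp0 hp]
  calc _ ≤ (ε ^ p.toReal) ^ (1 / p.toReal) := ENNReal.rpow_le_rpow hfin (by positivity)
    _ = ε := by rw [← ENNReal.rpow_mul, one_div, mul_inv_cancel₀ hr.ne', ENNReal.rpow_one]

/-- Mollifications converge in `L^p` for finite `p`. -/
lemma tendsto_eLpNorm_mollify_sub {p : ℝ≥0∞} (hp1 : 1 ≤ p) (hp : p ≠ ⊤) {f : E → ℝ}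
    (hf : MemLp f p μ) {ρ : ℕ → ContDiffBump (0 : E)}
    (hρ : Tendsto (fun n => (ρ n).rOut) atTop (𝓝 0)) :
    Tendsto (fun n => eLpNorm (fun x => mollify μ (ρ n) f x - f x) p μ) atTop (𝓝 0) := by
  rw [ENNReal.tendsto_nhds_zero]
  intro ε hε
  have h1 := (ENNReal.tendsto_nhds_zero.1 (tendsto_eLpNorm_translate hp1 hp hf)) ε hε
  obtain ⟨δ, hδ, h2⟩ := Metric.eventually_nhds_iff_ball.1 h1
  filter_upwards [hρ.eventually (gt_mem_nhds hδ)] with n hn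
  exact eLpNorm_mollify_sub_le hp1 hp hf (ρ n)
    fun t ht => h2 t (Metric.ball_subset_ball hn.le ht)

/-- The bounded ratio of outer to inner radius is what the Lebesgue differentiation argument for
a.e. convergence needs. -/
lemma exists_contDiffBump_seq : ∃ ρ : ℕ → ContDiffBump (0 : E),
    Tendsto (fun n => (ρ n).rOut) atTop (𝓝 0) ∧ ∀ n, (ρ n).rOut ≤ 2 * (ρ n).rIn := by
  refine ⟨fun n => ⟨1 / (n + 1) / 2, 1 / (n + 1), by positivity, ?_⟩, ?_, fun n => ?_⟩
  · exact half_lt_self (by positivity)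
  · exact tendsto_one_div_add_atTop_nhds_zero_nat
  · exact le_of_eq (by ring)

lemma tendsto_ae_mollify {f : E → ℝ} (hf : LocallyIntegrable f μ) {ρ : ℕ → ContDiffBump (0 : E)}
    (hρ : Tendsto (fun n => (ρ n).rOut) atTop (𝓝 0)) (hρ2 : ∀ n, (ρ n).rOut ≤ 2 * (ρ n).rIn) :
    ∀ᵐ x ∂μ, Tendsto (fun n => mollify μ (ρ n) f x) atTop (𝓝 (f x)) :=
  ContDiffBump.ae_convolution_tendsto_right_of_locallyIntegrable (K := 2) hρ
    (Eventually.of_forall hρ2) hf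

end Mollification

/-! ### L¹ limits of products with bounded, a.e. convergent factors. -/

section ConvergenceInMean

variable {α : Type*} [MeasurableSpace α] {ν : Measure α}

/-- Split cₙaₙ - ca = cₙ(aₙ - a) + (cₙ - c)a. The first term is small because cₙ is bounded, the
second by dominated convergence with majorant 2C|a|. -/
lemma tendsto_eLpNorm_one_mul {a : α → ℝ} {an : ℕ → α → ℝ} {c : α → ℝ} {cn : ℕ → α → ℝ} {C : ℝ}
    (ha : Integrable a ν) (han : ∀ n, AEStronglyMeasurable (an n) ν)
    (hlim : Tendsto (fun n => eLpNorm (fun x => an n x - a x) 1 ν) atTop (𝓝 0))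
    (hcn : ∀ n, AEStronglyMeasurable (cn n) ν) (hC : ∀ n, ∀ᵐ x ∂ν, |cn n x| ≤ C)
    (hc : ∀ᵐ x ∂ν, Tendsto (fun n => cn n x) atTop (𝓝 (c x))) :
    Tendsto (fun n => eLpNorm (fun x => cn n x * an n x - c x * a x) 1 ν) atTop (𝓝 0) := by
  have hcm : AEStronglyMeasurable c ν := aestronglyMeasurable_of_tendsto_ae atTop hcn hc
  have hdom : Tendsto (fun n => ∫⁻ x, ‖(cn n x - c x) * a x‖ₑ ∂ν) atTop (𝓝 0) := by
    have h1 := tendsto_lintegral_of_dominated_convergence' (μ := ν) (f := fun _ => (0 : ℝ≥0∞))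
      (F := fun n x => ‖(cn n x - c x) * a x‖ₑ) (fun x => ‖(C + C) * a x‖ₑ)
      (fun n => (((hcn n).sub hcm).mul ha.1).enorm) (fun n => ?_) ?_ ?_
    · simpa using h1
    · have hle : ∀ᵐ x ∂ν, |c x| ≤ C := by
        filter_upwards [hc, ae_all_iff.2 hC] with x hx hx2
        exact le_of_tendsto hx.abs (Eventually.of_forall hx2)
      filter_upwards [hC n, hle] with x h1 h2
      rw [enorm_mul, enorm_mul]
      gcongr
      rw [Real.enorm_eq_ofReal_abs, Real.enorm_eq_ofReal_abs]
      exact ENNReal.ofReal_le_ofReal (((abs_sub _ _).trans (add_le_add h1 h2)).trans (le_abs_self _))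
    · exact (ha.const_mul (C + C)).2.ne
    · filter_upwards [hc] with x hx
      have h2 : Tendsto (fun n => (cn n x - c x) * a x) atTop (𝓝 0) := by
        simpa using (hx.sub_const (c x)).mul_const (a x)
      simpa using h2.enorm
  have hmain : Tendsto (fun n => ENNReal.ofReal C * eLpNorm (fun x => an n x - a x) 1 ν
      + ∫⁻ x, ‖(cn n x - c x) * a x‖ₑ ∂ν) atTop (𝓝 0) := by
    simpa using (ENNReal.Tendsto.const_mul hlim (Or.inr ENNReal.ofReal_ne_top)).add hdom
  refine tendsto_of_tendsto_of_tendsto_of_le_of_le tendsto_const_nhds hmain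
    (fun _ => zero_le) fun n => ?_
  have hm : AEMeasurable (fun x => ENNReal.ofReal C * ‖an n x - a x‖ₑ) ν :=
    ((han n).sub ha.1).enorm.const_mul _
  simp only [eLpNorm_one_eq_lintegral_enorm]
  rw [← lintegral_const_mul' _ _ ENNReal.ofReal_ne_top,
    ← lintegral_add_left' hm]
  refine lintegral_mono_ae ?_
  filter_upwards [hC n] with x hx
  have : cn n x * an n x - c x * a x = cn n x * (an n x - a x) + (cn n x - c x) * a x := by ring
  rw [this]
  refine (enorm_add_le _ _).trans (add_le_add_left ?_ _)
  rw [enorm_mul, Real.enorm_eq_ofReal_abs (cn n x)]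
  gcongr

lemma tendsto_integral_mul_of_tendsto {a : α → ℝ} {an : ℕ → α → ℝ} {c : α → ℝ} {cn : ℕ → α → ℝ}
    {C : ℝ} (ha : Integrable a ν) (han : ∀ n, Integrable (an n) ν)
    (hlim : Tendsto (fun n => eLpNorm (fun x => an n x - a x) 1 ν) atTop (𝓝 0))
    (hcn : ∀ n, AEStronglyMeasurable (cn n) ν) (hC : ∀ n, ∀ᵐ x ∂ν, |cn n x| ≤ C)
    (hc : ∀ᵐ x ∂ν, Tendsto (fun n => cn n x) atTop (𝓝 (c x))) :
    Tendsto (fun n => ∫ x, cn n x * an n x ∂ν) atTop (𝓝 (∫ x, c x * a x ∂ν)) := by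
  have hcm : AEStronglyMeasurable c ν := aestronglyMeasurable_of_tendsto_ae atTop hcn hc
  have hle : ∀ᵐ x ∂ν, ‖c x‖ ≤ C := by
    filter_upwards [hc, ae_all_iff.2 hC] with x hx hx2
    exact le_of_tendsto hx.abs (Eventually.of_forall hx2)
  refine tendsto_integral_of_L1' _ (ha.bdd_mul hcm hle).1
    (Eventually.of_forall fun n => (han n).bdd_mul (hcn n) (hC n)) ?_
  exact tendsto_eLpNorm_one_mul ha (fun n => (han n).1) hlim hcn hC hc

end ConvergenceInMean

/-! ### Weak partial derivatives: uniqueness and local smooth approximation. -/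

section WeakDerivative

variable {m : ℕ} {Ω : Set (EuclideanSpace ℝ (Fin m))} {u v g g' : EuclideanSpace ℝ (Fin m) → ℝ}
  {i : Fin m}

/-- `g` is the weak `i`-th partial derivative of `u` in `Ω`. -/
def IsWeakPartial (Ω : Set (EuclideanSpace ℝ (Fin m))) (u : EuclideanSpace ℝ (Fin m) → ℝ)
    (i : Fin m) (g : EuclideanSpace ℝ (Fin m) → ℝ) : Prop :=
  LocallyIntegrableOn u Ω volume ∧ LocallyIntegrableOn g Ω volume ∧
    ∀ φ : EuclideanSpace ℝ (Fin m) → ℝ, IsTestFunction Ω φ →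
      ∫ x in Ω, u x * fderiv ℝ φ x (EuclideanSpace.single i 1) = - ∫ x in Ω, g x * φ x

lemma locallyIntegrableOn_apply {G : EuclideanSpace ℝ (Fin m) → EuclideanSpace ℝ (Fin m)}
    (hG : LocallyIntegrableOn G Ω volume) (i : Fin m) :
    LocallyIntegrableOn (fun x => G x i) Ω volume := by
  intro x hx
  obtain ⟨s, hs, hi⟩ := hG x hx
  exact ⟨s, hs, (EuclideanSpace.proj (𝕜 := ℝ) i).integrable_comp hi⟩

lemma IsWeakGrad.isWeakPartial {G : EuclideanSpace ℝ (Fin m) → EuclideanSpace ℝ (Fin m)}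
    (h : IsWeakGrad Ω u G) (i : Fin m) : IsWeakPartial Ω u i (fun x => G x i) :=
  ⟨h.1, locallyIntegrableOn_apply h.2.1 i, fun φ hφ => h.2.2 φ hφ i⟩

lemma integrable_mul_of_compactSupport (hu : LocallyIntegrableOn u Ω volume)
    {ψ : EuclideanSpace ℝ (Fin m) → ℝ} (hc : Continuous ψ) (hs : HasCompactSupport ψ)
    (hsub : tsupport ψ ⊆ Ω) : Integrable (fun x => u x * ψ x) volume := by
  have h1 : IntegrableOn u (tsupport ψ) := hu.integrableOn_compact_subset hsub hs
  obtain ⟨C, hC⟩ := hs.exists_bound_of_continuous hc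
  have h2 : IntegrableOn (fun x => u x * ψ x) (tsupport ψ) :=
    h1.mul_bdd hc.aestronglyMeasurable (Eventually.of_forall hC)
  refine (integrableOn_iff_integrable_of_support_subset ?_).1 h2
  intro x hx
  exact subset_tsupport _ (fun h => hx (by simp [h]))

lemma IsTestFunction.continuous {φ : EuclideanSpace ℝ (Fin m) → ℝ} (h : IsTestFunction Ω φ) :
    Continuous φ := h.1.continuous

lemma IsTestFunction.continuous_partial {φ : EuclideanSpace ℝ (Fin m) → ℝ}
    (h : IsTestFunction Ω φ) (e : EuclideanSpace ℝ (Fin m)) :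
    Continuous (fun x => fderiv ℝ φ x e) :=
  (h.1.continuous_fderiv (by simp)).clm_apply continuous_const

lemma tsupport_partial_subset (φ : EuclideanSpace ℝ (Fin m) → ℝ) (e : EuclideanSpace ℝ (Fin m)) :
    tsupport (fun x => fderiv ℝ φ x e) ⊆ tsupport φ := tsupport_fderiv_apply_subset ℝ e

lemma IsTestFunction.hasCompactSupport_partial {φ : EuclideanSpace ℝ (Fin m) → ℝ}
    (h : IsTestFunction Ω φ) (e : EuclideanSpace ℝ (Fin m)) :
    HasCompactSupport (fun x => fderiv ℝ φ x e) := h.2.1.fderiv_apply ℝ e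

lemma IsTestFunction.integrable_mul {φ : EuclideanSpace ℝ (Fin m) → ℝ}
    (h : IsTestFunction Ω φ) (hu : LocallyIntegrableOn u Ω volume) :
    Integrable (fun x => u x * φ x) volume :=
  integrable_mul_of_compactSupport hu h.continuous h.2.1 h.2.2

lemma IsTestFunction.integrable_mul_partial {φ : EuclideanSpace ℝ (Fin m) → ℝ}
    (h : IsTestFunction Ω φ) (hu : LocallyIntegrableOn u Ω volume) (e : EuclideanSpace ℝ (Fin m)) :
    Integrable (fun x => u x * fderiv ℝ φ x e) volume :=
  integrable_mul_of_compactSupport hu (h.continuous_partial e) (h.hasCompactSupport_partial e)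
    ((tsupport_partial_subset φ e).trans h.2.2)

lemma setIntegral_eq_of_tsupport {s : Set (EuclideanSpace ℝ (Fin m))}
    {ψ : EuclideanSpace ℝ (Fin m) → ℝ} (hψ : tsupport ψ ⊆ s) (u : EuclideanSpace ℝ (Fin m) → ℝ) :
    ∫ x in s, u x * ψ x = ∫ x, u x * ψ x :=
  setIntegral_eq_integral_of_forall_compl_eq_zero fun x hx => by
    rw [image_eq_zero_of_notMem_tsupport (fun h => hx (hψ h)), mul_zero]

lemma IsWeakPartial.sub (hu : IsWeakPartial Ω u i g) (hv : IsWeakPartial Ω v i g') :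
    IsWeakPartial Ω (fun x => u x - v x) i (fun x => g x - g' x) := by
  refine ⟨hu.1.sub hv.1, hu.2.1.sub hv.2.1, fun φ hφ => ?_⟩
  simp only [sub_mul]
  rw [integral_sub (hφ.integrable_mul_partial hu.1 _).integrableOn
    (hφ.integrable_mul_partial hv.1 _).integrableOn,
    integral_sub (hφ.integrable_mul hu.2.1).integrableOn
    (hφ.integrable_mul hv.2.1).integrableOn, hu.2.2 φ hφ, hv.2.2 φ hφ]
  ring

lemma IsWeakPartial.ae_eq (hΩ : IsOpen Ω) (h : IsWeakPartial Ω u i g)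
    (h' : IsWeakPartial Ω u i g') : g =ᵐ[volume.restrict Ω] g' := by
  have key := hΩ.ae_eq_zero_of_integral_contDiff_smul_eq_zero (μ := volume)
    (h.2.1.sub h'.2.1) (fun φ h1 h2 h3 => ?_)
  · refine (ae_restrict_iff' hΩ.measurableSet).2 ?_
    filter_upwards [key] with x hx hxΩ
    exact sub_eq_zero.1 (hx hxΩ)
  · have hφ : IsTestFunction Ω φ := ⟨h1, h2, h3⟩
    have e1 := h.2.2 φ hφ
    rw [h'.2.2 φ hφ, setIntegral_eq_of_tsupport h3, setIntegral_eq_of_tsupport h3] at e1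
    have : ∀ x, φ x • (g - g') x = g x * φ x - g' x * φ x := fun x => by
      simp only [Pi.sub_apply, smul_eq_mul]; ring
    simp only [this]
    rw [integral_sub (hφ.integrable_mul h.2.1) (hφ.integrable_mul h'.2.1)]
    linarith

/-- The derivative is moved onto the kernel, and y ↦ ρ(x - y) is then an admissible test function
because its support lies in `K'`. The same support condition makes the truncation by the indicator
invisible. -/
lemma fderiv_mollify_apply {K' : Set (EuclideanSpace ℝ (Fin m))} (hK' : K' ⊆ Ω)
    (hK'm : MeasurableSet K') (hu1 : IntegrableOn u K')
    (h : IsWeakPartial Ω u i g) (ρ : ContDiffBump (0 : EuclideanSpace ℝ (Fin m)))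
    {x : EuclideanSpace ℝ (Fin m)} (hx : Metric.closedBall x ρ.rOut ⊆ K') :
    fderiv ℝ (mollify volume ρ (K'.indicator u)) x (EuclideanSpace.single i 1)
      = mollify volume ρ (K'.indicator g) x := by
  set e : EuclideanSpace ℝ (Fin m) := EuclideanSpace.single i 1 with he
  have hu : LocallyIntegrable (K'.indicator u) volume :=
    ((integrable_indicator_iff hK'm).2 hu1).locallyIntegrable
  have hρ1 : ContDiff ℝ 1 (ρ.normed volume) := ρ.contDiff_normed
  let φ : EuclideanSpace ℝ (Fin m) → ℝ := fun y => ρ.normed volume (x - y)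
  have hsupp : tsupport φ ⊆ Metric.closedBall x ρ.rOut := by
    refine closure_minimal (fun y hy => ?_) Metric.isClosed_closedBall
    have : x - y ∈ Function.support (ρ.normed volume) := hy
    rw [ρ.support_normed_eq] at this
    rw [Metric.mem_closedBall, dist_comm, dist_eq_norm]
    simpa using (Metric.mem_ball.1 this).le
  have hφ : IsTestFunction Ω φ :=
    ⟨ρ.contDiff_normed.comp (contDiff_const.sub contDiff_id),
      HasCompactSupport.of_support_subset_isCompact (isCompact_closedBall x ρ.rOut)
        ((subset_tsupport _).trans hsupp), hsupp.trans (hx.trans hK')⟩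
  -- This sign, from the reflection y ↦ x - y, cancels the one in the definition of the weak
  -- derivative.
  have hdφ : ∀ y, fderiv ℝ φ y e = - fderiv ℝ (ρ.normed volume) (x - y) e := by
    intro y
    have h1 : HasFDerivAt (fun y => x - y) (-ContinuousLinearMap.id ℝ _) y :=
      (hasFDerivAt_id y).const_sub x
    have h2 := ((hρ1.differentiable (by simp)) (x - y)).hasFDerivAt.comp y h1
    have h3 : fderiv ℝ φ y = _ := h2.fderiv
    rw [h3]
    simp
  have hd := (HasCompactSupport.hasFDerivAt_convolution_left (ContinuousLinearMap.lsmul ℝ ℝ)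
    ρ.hasCompactSupport_normed hρ1 hu x).fderiv
  have hint := HasCompactSupport.convolutionExists_left
    (ContinuousLinearMap.precompL (EuclideanSpace ℝ (Fin m)) (ContinuousLinearMap.lsmul ℝ ℝ))
    (ρ.hasCompactSupport_normed.fderiv ℝ) (hρ1.continuous_fderiv (by simp)) hu x
  have hφK : tsupport φ ⊆ K' := hsupp.trans hx
  have hind : ∀ (f ψ : EuclideanSpace ℝ (Fin m) → ℝ), tsupport ψ ⊆ K' → ∀ y,
      K'.indicator f y * ψ y = f y * ψ y := by
    intro f ψ hψ y
    by_cases hy : y ∈ K'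
    · rw [Set.indicator_of_mem hy]
    · rw [image_eq_zero_of_notMem_tsupport (fun h => hy (hψ h)), mul_zero, mul_zero]
  have e1 : fderiv ℝ (mollify volume ρ (K'.indicator u)) x e
      = ∫ t, K'.indicator u (x - t) * fderiv ℝ (ρ.normed volume) t e := by
    unfold mollify
    rw [hd, convolution_def, ContinuousLinearMap.integral_apply hint]
    refine integral_congr_ae (Eventually.of_forall fun t => ?_)
    simp [ContinuousLinearMap.precompL_apply, mul_comm]
  have e2 : ∫ t, K'.indicator u (x - t) * fderiv ℝ (ρ.normed volume) t e
      = ∫ y, K'.indicator u y * fderiv ℝ (ρ.normed volume) (x - y) e := by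
    rw [← integral_sub_left_eq_self _ volume x]
    simp
  have e3 : mollify volume ρ (K'.indicator g) x = ∫ y, K'.indicator g y * φ y := by
    rw [mollify_apply, ← integral_sub_left_eq_self _ volume x]
    simp [φ, mul_comm]
  have e4 := h.2.2 φ hφ
  rw [setIntegral_eq_of_tsupport hφ.2.2,
    setIntegral_eq_of_tsupport ((tsupport_partial_subset φ _).trans hφ.2.2)] at e4
  rw [e1, e2, e3]
  simp only [hind g φ hφK]
  rw [← neg_inj, ← e4, ← integral_neg]
  refine integral_congr_ae (Eventually.of_forall fun y => ?_)
  simp only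
  rw [← mul_neg, ← hdφ, hind u _ ((tsupport_partial_subset φ _).trans hφK)]

lemma exists_smooth_approx (hΩ : IsOpen Ω) (h : IsWeakPartial Ω u i g)
    {K : Set (EuclideanSpace ℝ (Fin m))} (hK : IsCompact K) (hKΩ : K ⊆ Ω) :
    ∃ U : ℕ → EuclideanSpace ℝ (Fin m) → ℝ, (∀ n, ContDiff ℝ (∞ : ℕ∞ω) (U n)) ∧
      Tendsto (fun n => eLpNorm (fun x => U n x - u x) 1 (volume.restrict K)) atTop (𝓝 0) ∧
      Tendsto (fun n => eLpNorm (fun x => fderiv ℝ (U n) x (EuclideanSpace.single i 1) - g x) 1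
        (volume.restrict K)) atTop (𝓝 0) ∧
      ∀ᵐ x ∂(volume.restrict K), Tendsto (fun n => U n x) atTop (𝓝 (u x)) := by
  -- The collar of width δ keeps the mollifier centred at points of K inside Ω once its radius is
  -- below δ. Hence the derivative formula is only available for large n.
  obtain ⟨δ, hδ, hδΩ⟩ := hK.exists_cthickening_subset_open hΩ hKΩ
  set K' := Metric.cthickening δ K
  have hK' : IsCompact K' := hK.cthickening
  have hKK' : K ⊆ K' := Metric.self_subset_cthickening K
  have hK'm : MeasurableSet K' := hK'.measurableSet
  have hKm : MeasurableSet K := hK.measurableSet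
  have hu1 : IntegrableOn u K' := h.1.integrableOn_compact_subset hδΩ hK'
  have hg1 : IntegrableOn g K' := h.2.1.integrableOn_compact_subset hδΩ hK'
  have hu2 := (integrable_indicator_iff hK'm).2 hu1
  have hg2 := (integrable_indicator_iff hK'm).2 hg1
  obtain ⟨ρ, hρ, hρ2⟩ := exists_contDiffBump_seq (E := EuclideanSpace ℝ (Fin m))
  refine ⟨fun n => mollify volume (ρ n) (K'.indicator u),
    fun n => contDiff_mollify _ hu2.locallyIntegrable, ?_, ?_, ?_⟩
  · refine tendsto_of_tendsto_of_tendsto_of_le_of_le tendsto_const_nhds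
      (tendsto_eLpNorm_mollify_sub le_rfl ENNReal.one_ne_top (memLp_one_iff_integrable.2 hu2) hρ)
      (fun _ => zero_le) fun n => ?_
    refine le_trans (le_of_eq (eLpNorm_congr_ae ?_)) (eLpNorm_restrict_le _ _ _ K)
    filter_upwards [ae_restrict_mem hKm] with x hx
    rw [Set.indicator_of_mem (hKK' hx)]
  · refine tendsto_of_tendsto_of_tendsto_of_le_of_le' tendsto_const_nhds
      (tendsto_eLpNorm_mollify_sub le_rfl ENNReal.one_ne_top (memLp_one_iff_integrable.2 hg2) hρ)
      (Eventually.of_forall fun _ => zero_le) ?_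
    filter_upwards [hρ.eventually (gt_mem_nhds hδ)] with n hn
    refine le_trans (le_of_eq (eLpNorm_congr_ae ?_)) (eLpNorm_restrict_le _ _ _ K)
    filter_upwards [ae_restrict_mem hKm] with x hx
    rw [fderiv_mollify_apply hδΩ hK'm hu1 h (ρ n), Set.indicator_of_mem (hKK' hx)]
    exact (Metric.closedBall_subset_closedBall hn.le).trans
      (Metric.closedBall_subset_cthickening hx δ)
  · filter_upwards [ae_restrict_of_ae (tendsto_ae_mollify hu2.locallyIntegrable hρ hρ2),
      ae_restrict_mem hKm] with x hx hxK
    rwa [Set.indicator_of_mem (hKK' hxK)] at hx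

end WeakDerivative

/-! ### The chain rule and the weak derivative of the positive part. -/

section ChainRule

variable {m : ℕ} {Ω : Set (EuclideanSpace ℝ (Fin m))} {u g : EuclideanSpace ℝ (Fin m) → ℝ}
  {i : Fin m}

lemma locallyIntegrableOn_of_norm_le {f f' : EuclideanSpace ℝ (Fin m) → ℝ}
    (hf : LocallyIntegrableOn f Ω volume) (hm : AEStronglyMeasurable f' (volume.restrict Ω))
    (hle : ∀ x, ‖f' x‖ ≤ ‖f x‖) : LocallyIntegrableOn f' Ω volume := by
  intro x hx
  obtain ⟨s, hs, hi⟩ := hf x hx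
  exact ⟨s ∩ Ω, inter_mem hs self_mem_nhdsWithin, Integrable.mono
    (hi.mono_set Set.inter_subset_left) (hm.mono_set Set.inter_subset_right)
    (Eventually.of_forall hle)⟩

lemma abs_sub_le_of_abs_deriv_le {h : ℝ → ℝ} (hd : Differentiable ℝ h) {C : ℝ}
    (hC : ∀ s, |deriv h s| ≤ C) (s t : ℝ) : |h s - h t| ≤ C * |s - t| :=
  convex_univ.norm_image_sub_le_of_norm_deriv_le (fun x _ => hd x) (fun x _ => hC x)
    (Set.mem_univ t) (Set.mem_univ s)

lemma locallyIntegrableOn_comp {h : ℝ → ℝ} (hh : ContDiff ℝ 1 h) {C : ℝ}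
    (hC : ∀ s, |deriv h s| ≤ C) (hu : LocallyIntegrableOn u Ω volume) :
    LocallyIntegrableOn (fun x => h (u x)) Ω volume := by
  have h1 : LocallyIntegrableOn (fun x => |h 0| + C * ‖u x‖) Ω volume :=
    (locallyIntegrableOn_const _).add (hu.norm.smul C)
  refine locallyIntegrableOn_of_norm_le h1
    (hh.continuous.comp_aestronglyMeasurable hu.aestronglyMeasurable) fun x => ?_
  have h2 := abs_sub_le_of_abs_deriv_le (hh.differentiable one_ne_zero) hC (u x) 0
  have hC0 : 0 ≤ C := (abs_nonneg _).trans (hC 0)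
  rw [sub_zero] at h2
  rw [Real.norm_eq_abs, Real.norm_eq_abs, Real.norm_eq_abs]
  have h3 := abs_sub_abs_le_abs_sub (h (u x)) (h 0)
  refine le_trans ?_ (le_abs_self _)
  linarith

/-- The chain rule for weak derivatives. -/
lemma IsWeakPartial.comp (hΩ : IsOpen Ω) (hw : IsWeakPartial Ω u i g) {h : ℝ → ℝ}
    (hh : ContDiff ℝ 1 h) {C : ℝ} (hC : ∀ s, |deriv h s| ≤ C) :
    IsWeakPartial Ω (fun x => h (u x)) i (fun x => deriv h (u x) * g x) := by
  have hdc : Continuous (deriv h) := hh.continuous_deriv le_rfl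
  have hdiff := hh.differentiable one_ne_zero
  have hC0 : 0 ≤ C := (abs_nonneg _).trans (hC 0)
  have hlu := locallyIntegrableOn_comp hh hC hw.1
  refine ⟨hlu, ?_, fun φ hφ => ?_⟩
  · refine locallyIntegrableOn_of_norm_le (hw.2.1.smul C)
      ((hdc.comp_aestronglyMeasurable hw.1.aestronglyMeasurable).mul
        hw.2.1.aestronglyMeasurable) fun x => ?_
    simp only [Pi.smul_apply, smul_eq_mul, norm_mul, Real.norm_eq_abs, abs_of_nonneg hC0]
    exact mul_le_mul_of_nonneg_right (hC _) (abs_nonneg _)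
  · set e : EuclideanSpace ℝ (Fin m) := EuclideanSpace.single i 1 with he
    set K := tsupport φ with hKdef
    have hK : IsCompact K := hφ.2.1
    -- Classical integration by parts holds for h(Uₙ) and passes to the limit: h is Lipschitz, so
    -- h(Uₙ) converges in L¹(K), while h'(Uₙ) is bounded and converges a.e., so h'(Uₙ) ∂Uₙ can be
    -- handled as a product.
    obtain ⟨U, hU, hU1, hU2, hU3⟩ := exists_smooth_approx hΩ hw hK hφ.2.2
    have hgK : IntegrableOn g K := hw.2.1.integrableOn_compact_subset hφ.2.2 hK
    have huK : IntegrableOn (fun x => h (u x)) K := hlu.integrableOn_compact_subset hφ.2.2 hK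
    have hcint : ∀ ψ : EuclideanSpace ℝ (Fin m) → ℝ, Continuous ψ → IntegrableOn ψ K :=
      fun ψ hψ => hψ.continuousOn.integrableOn_compact hK
    have hUd : ∀ n, Differentiable ℝ (U n) := fun n => (hU n).differentiable (by simp)
    have hUc : ∀ n, Continuous (fun x => fderiv ℝ (U n) x e) := fun n =>
      ((hU n).continuous_fderiv (by simp)).clm_apply continuous_const
    have hbd : ∀ ψ : EuclideanSpace ℝ (Fin m) → ℝ, Continuous ψ → HasCompactSupport ψ →
        ∃ B, ∀ x, |ψ x| ≤ B := fun ψ hψ hs => hs.exists_bound_of_continuous hψ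
    have hφ'c := hφ.continuous_partial e
    obtain ⟨B1, hB1⟩ := hbd _ hφ'c (hφ.hasCompactSupport_partial e)
    obtain ⟨B2, hB2⟩ := hbd _ hφ.continuous hφ.2.1
    have hB20 : 0 ≤ B2 := (abs_nonneg _).trans (hB2 0)
    have hcomp1 : Tendsto (fun n => eLpNorm (fun x => h (U n x) - h (u x)) 1
        (volume.restrict K)) atTop (𝓝 0) := by
      have hlim := ENNReal.Tendsto.const_mul hU1 (a := ENNReal.ofReal C)
        (Or.inr ENNReal.ofReal_ne_top)
      rw [mul_zero] at hlim
      refine tendsto_of_tendsto_of_tendsto_of_le_of_le tendsto_const_nhds hlim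
        (fun _ => zero_le) fun n => ?_
      refine eLpNorm_le_mul_eLpNorm_of_ae_le_mul (Eventually.of_forall fun x => ?_) 1
      exact abs_sub_le_of_abs_deriv_le hdiff hC _ _
    have l1 : Tendsto (fun n => ∫ x in K, fderiv ℝ φ x e * h (U n x)) atTop
        (𝓝 (∫ x in K, fderiv ℝ φ x e * h (u x))) :=
      tendsto_integral_mul_of_tendsto huK
        (fun n => hcint _ (hh.continuous.comp (hU n).continuous)) hcomp1
        (fun n => hφ'c.aestronglyMeasurable) (fun n => Eventually.of_forall hB1)
        (Eventually.of_forall fun x => tendsto_const_nhds)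
    have l2 : Tendsto (fun n => ∫ x in K, (φ x * deriv h (U n x)) * fderiv ℝ (U n) x e) atTop
        (𝓝 (∫ x in K, (φ x * deriv h (u x)) * g x)) := by
      refine tendsto_integral_mul_of_tendsto (C := B2 * C) hgK (fun n => hcint _ (hUc n)) hU2
        (fun n => (hφ.continuous.mul (hdc.comp (hU n).continuous)).aestronglyMeasurable)
        (fun n => Eventually.of_forall fun x => ?_) ?_
      · rw [abs_mul]
        exact mul_le_mul (hB2 x) (hC _) (abs_nonneg _) hB20
      · filter_upwards [hU3] with x hx
        exact tendsto_const_nhds.mul ((hdc.tendsto _).comp hx)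
    have hparts : ∀ n, ∫ x in K, fderiv ℝ φ x e * h (U n x)
        = - ∫ x in K, (φ x * deriv h (U n x)) * fderiv ℝ (U n) x e := by
      intro n
      have hV : ContDiff ℝ 1 (fun x => h (U n x)) := hh.comp ((hU n).of_le (by simp))
      have hVd : ∀ x, fderiv ℝ (fun x => h (U n x)) x e
          = deriv h (U n x) * fderiv ℝ (U n) x e := by
        intro x
        have h1 : HasFDerivAt (fun x => h (U n x)) _ x :=
          (hdiff (U n x)).hasDerivAt.comp_hasFDerivAt x (hUd n x).hasFDerivAt
        rw [h1.fderiv]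
        simp
      have hVl : LocallyIntegrableOn (fun x => h (U n x)) Ω volume :=
        hV.continuous.locallyIntegrable.locallyIntegrableOn _
      have hVl' : LocallyIntegrableOn (fun x => fderiv ℝ (fun x => h (U n x)) x e) Ω volume :=
        ((hV.continuous_fderiv one_ne_zero).clm_apply
          continuous_const).locallyIntegrable.locallyIntegrableOn _
      have h2 := integral_mul_fderiv_eq_neg_fderiv_mul_of_integrable (μ := volume) (v := e)
        (f := fun x => h (U n x)) (g := φ) (hφ.integrable_mul hVl')
        (hφ.integrable_mul_partial hVl e) (hφ.integrable_mul hVl)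
        (fun x _ => hV.differentiable one_ne_zero x)
        (fun x _ => hφ.1.differentiable (by simp) x)
      rw [← setIntegral_eq_of_tsupport (tsupport_partial_subset φ e),
        ← setIntegral_eq_of_tsupport (s := K) subset_rfl] at h2
      refine Eq.trans ?_ (h2.trans (congrArg Neg.neg ?_))
      · simp only [mul_comm, hKdef]
      · refine integral_congr_ae (Eventually.of_forall fun x => ?_)
        simp only [hVd]
        ring
    have huniq := tendsto_nhds_unique l1 ((l2.neg).congr fun n => (hparts n).symm)
    rw [setIntegral_eq_of_tsupport ((tsupport_partial_subset φ e).trans hφ.2.2),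
      setIntegral_eq_of_tsupport hφ.2.2,
      ← setIntegral_eq_of_tsupport (s := K) (tsupport_partial_subset φ e),
      ← setIntegral_eq_of_tsupport (s := K) subset_rfl]
    refine Eq.trans ?_ (huniq.trans (congrArg Neg.neg ?_))
    · simp only [mul_comm]
    · refine integral_congr_ae (Eventually.of_forall fun x => ?_)
      simp only
      ring

/-- Smooth approximations `s ↦ s T(n s)` of the positive part. -/
noncomputable def smoothPos (n : ℕ) (s : ℝ) : ℝ := s * Real.smoothTransition (n * s)

lemma contDiff_smoothPos (n : ℕ) : ContDiff ℝ 1 (smoothPos n) :=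
  contDiff_id.mul (Real.smoothTransition.contDiff.comp (contDiff_const.mul contDiff_id))

lemma deriv_smoothPos (n : ℕ) (s : ℝ) : deriv (smoothPos n) s =
    Real.smoothTransition (n * s) + n * s * deriv Real.smoothTransition (n * s) := by
  have h0 : HasDerivAt (fun s : ℝ => (n : ℝ) * s) n s := by
    simpa using (hasDerivAt_id s).const_mul (n : ℝ)
  have hT : Differentiable ℝ Real.smoothTransition :=
    (Real.smoothTransition.contDiff (n := 1)).differentiable (by simp)
  have h1 := (hasDerivAt_id s).mul ((hT (n * s)).hasDerivAt.comp s h0)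
  have h2 : HasDerivAt (smoothPos n) _ s := h1
  rw [h2.deriv]
  simp
  ring

lemma deriv_smoothTransition_of_one_lt {s : ℝ} (hs : 1 < s) :
    deriv Real.smoothTransition s = 0 := by
  have : Real.smoothTransition =ᶠ[𝓝 s] fun _ => 1 := by
    filter_upwards [lt_mem_nhds hs] with t ht
    exact Real.smoothTransition.one_of_one_le ht.le
  rw [this.deriv_eq, deriv_const]

lemma deriv_smoothTransition_of_neg {s : ℝ} (hs : s < 0) :
    deriv Real.smoothTransition s = 0 := by
  have : Real.smoothTransition =ᶠ[𝓝 s] fun _ => 0 := by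
    filter_upwards [gt_mem_nhds hs] with t ht
    exact Real.smoothTransition.zero_of_nonpos ht.le
  rw [this.deriv_eq, deriv_const]

/-- With T the smooth transition, the derivative is T(ns) + ns T'(ns). Since T' vanishes outside [0,
1], the factor ns is at most 1 wherever it counts, which gives a bound independent of n. -/
lemma exists_bound_deriv_smoothPos : ∃ C : ℝ, ∀ n s, |deriv (smoothPos n) s| ≤ C := by
  have hc : Continuous (deriv Real.smoothTransition) :=
    (Real.smoothTransition.contDiff (n := 1)).continuous_deriv le_rfl
  obtain ⟨B, hB⟩ := (isCompact_Icc (a := (0 : ℝ)) (b := 1)).exists_bound_of_continuousOn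
    hc.continuousOn
  have hB0 : 0 ≤ B := (norm_nonneg _).trans (hB 0 (by simp))
  refine ⟨1 + B, fun n s => ?_⟩
  rw [deriv_smoothPos]
  refine (abs_add_le _ _).trans (add_le_add ?_ ?_)
  · rw [abs_of_nonneg (Real.smoothTransition.nonneg _)]
    exact Real.smoothTransition.le_one _
  · rcases lt_or_ge ((n : ℝ) * s) 0 with h | h
    · simpa [deriv_smoothTransition_of_neg h]
    rcases lt_or_ge 1 ((n : ℝ) * s) with h' | h'
    · simpa [deriv_smoothTransition_of_one_lt h']
    rw [abs_mul, abs_of_nonneg h]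
    simpa using mul_le_mul h' (hB _ ⟨h, h'⟩) (norm_nonneg _) zero_le_one

lemma abs_smoothPos_le (n : ℕ) (s : ℝ) : |smoothPos n s| ≤ |s| := by
  rw [smoothPos, abs_mul, abs_of_nonneg (Real.smoothTransition.nonneg _)]
  exact mul_le_of_le_one_right (abs_nonneg _) (Real.smoothTransition.le_one _)

lemma eventually_one_lt_natCast_mul {s : ℝ} (hs : 0 < s) : ∀ᶠ n : ℕ in atTop, 1 < (n : ℝ) * s :=
  (tendsto_natCast_atTop_atTop.atTop_mul_const hs).eventually_gt_atTop 1

lemma tendsto_smoothPos (s : ℝ) :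
    Tendsto (fun n => smoothPos n s) atTop (𝓝 (max s 0)) := by
  rcases le_or_gt s 0 with hs | hs
  · refine tendsto_const_nhds.congr fun n => ?_
    rw [smoothPos, max_eq_right hs, Real.smoothTransition.zero_of_nonpos
      (mul_nonpos_of_nonneg_of_nonpos n.cast_nonneg hs), mul_zero]
  · refine tendsto_const_nhds.congr' ?_
    filter_upwards [eventually_one_lt_natCast_mul hs] with n hn
    rw [smoothPos, max_eq_left hs.le, Real.smoothTransition.one_of_one_le hn.le, mul_one]

/-- At s = 0 every derivative is 0, so the limit is the indicator of the open half-line. This fixes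
the gradient of the positive part to be 0 on the zero level set. -/
lemma tendsto_deriv_smoothPos (s : ℝ) :
    Tendsto (fun n => deriv (smoothPos n) s) atTop (𝓝 (if 0 < s then 1 else 0)) := by
  split_ifs with hs
  · refine tendsto_const_nhds.congr' ?_
    filter_upwards [eventually_one_lt_natCast_mul hs] with n hn
    rw [deriv_smoothPos, Real.smoothTransition.one_of_one_le hn.le,
      deriv_smoothTransition_of_one_lt hn]
    simp
  · refine tendsto_const_nhds.congr fun n => ?_
    have h : (n : ℝ) * s ≤ 0 := mul_nonpos_of_nonneg_of_nonpos n.cast_nonneg (not_lt.1 hs)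
    rw [deriv_smoothPos, Real.smoothTransition.zero_of_nonpos h]
    rcases h.lt_or_eq with h | h
    · simp [deriv_smoothTransition_of_neg h]
    · simp [h]

/-- The weak derivative of the positive part. -/
lemma IsWeakPartial.posPart (hΩ : IsOpen Ω) (hw : IsWeakPartial Ω u i g) :
    IsWeakPartial Ω (fun x => max (u x) 0) i (fun x => (if 0 < u x then 1 else 0) * g x) := by
  obtain ⟨C, hC⟩ := exists_bound_deriv_smoothPos
  have hn := fun n => hw.comp hΩ (contDiff_smoothPos n) (hC n)
  have hum : AEStronglyMeasurable u (volume.restrict Ω) := hw.1.aestronglyMeasurable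
  have him : AEStronglyMeasurable (fun x => if 0 < u x then (1 : ℝ) else 0)
      (volume.restrict Ω) :=
    ((Measurable.ite measurableSet_Ioi measurable_const
      measurable_const).comp_aemeasurable hum.aemeasurable).aestronglyMeasurable
  refine ⟨locallyIntegrableOn_of_norm_le hw.1
      ((continuous_id.max continuous_const).comp_aestronglyMeasurable hum) fun x => ?_,
    locallyIntegrableOn_of_norm_le hw.2.1 (him.mul hw.2.1.aestronglyMeasurable) fun x => ?_,
    fun φ hφ => ?_⟩
  · simp only [Real.norm_eq_abs]
    rw [abs_of_nonneg (le_max_right _ _)]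
    exact max_le (le_abs_self _) (abs_nonneg _)
  · split_ifs <;> simp
  · have e : ∀ n, ∫ x in Ω, smoothPos n (u x) * fderiv ℝ φ x (EuclideanSpace.single i 1)
        = -∫ x in Ω, deriv (smoothPos n) (u x) * g x * φ x := fun n => (hn n).2.2 φ hφ
    have l1 : Tendsto (fun n => ∫ x in Ω, smoothPos n (u x) *
        fderiv ℝ φ x (EuclideanSpace.single i 1)) atTop
        (𝓝 (∫ x in Ω, max (u x) 0 * fderiv ℝ φ x (EuclideanSpace.single i 1))) := by
      refine tendsto_integral_of_dominated_convergence
        (fun x => ‖u x * fderiv ℝ φ x (EuclideanSpace.single i 1)‖)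
        (fun n => ((hφ.integrable_mul_partial (hn n).1 _).integrableOn).1)
        (hφ.integrable_mul_partial hw.1 _).integrableOn.norm
        (fun n => Eventually.of_forall fun x => ?_)
        (Eventually.of_forall fun x => (tendsto_smoothPos _).mul_const _)
      rw [norm_mul, norm_mul]
      exact mul_le_mul_of_nonneg_right (abs_smoothPos_le _ _) (norm_nonneg _)
    have l2 : Tendsto (fun n => ∫ x in Ω, deriv (smoothPos n) (u x) * g x * φ x) atTop
        (𝓝 (∫ x in Ω, (if 0 < u x then 1 else 0) * g x * φ x)) := by
      refine tendsto_integral_of_dominated_convergence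
        (fun x => C * ‖g x * φ x‖)
        (fun n => ((hφ.integrable_mul (hn n).2.1).integrableOn).1)
        ((hφ.integrable_mul hw.2.1).integrableOn.norm.const_mul C)
        (fun n => Eventually.of_forall fun x => ?_)
        (Eventually.of_forall fun x =>
          ((tendsto_deriv_smoothPos _).mul_const _).mul_const _)
      rw [mul_assoc, norm_mul]
      exact mul_le_mul_of_nonneg_right (hC _ _) (norm_nonneg _)
    exact tendsto_nhds_unique l1 (l2.neg.congr fun n => (e n).symm)

end ChainRule

/-! ### Bounded limits of test functions and their extension by zero. -/

section TestLimits

variable {m : ℕ} {Ω : Set (EuclideanSpace ℝ (Fin m))} {f : EuclideanSpace ℝ (Fin m) → ℝ}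
  {p : EuclideanSpace ℝ (Fin m) → EuclideanSpace ℝ (Fin m)}

/-- `f` is an almost everywhere limit of uniformly bounded test functions whose gradients converge
to `p` in `L¹`. -/
def IsBoundedTestLimit (Ω : Set (EuclideanSpace ℝ (Fin m))) (f : EuclideanSpace ℝ (Fin m) → ℝ)
    (p : EuclideanSpace ℝ (Fin m) → EuclideanSpace ℝ (Fin m)) : Prop :=
  (∀ i, IntegrableOn (fun x => p x i) Ω) ∧
  ∃ (φ : ℕ → EuclideanSpace ℝ (Fin m) → ℝ) (C : ℝ), (∀ k, IsTestFunction Ω (φ k)) ∧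
    (∀ k x, |φ k x| ≤ C) ∧
    (∀ᵐ x ∂(volume.restrict Ω), Tendsto (fun k => φ k x) atTop (𝓝 (f x))) ∧
    ∀ i, Tendsto (fun k => eLpNorm (fun x => fderiv ℝ (φ k) x (EuclideanSpace.single i 1) - p x i)
      1 (volume.restrict Ω)) atTop (𝓝 0)

lemma tsupport_mono_of_zero {φ ψ : EuclideanSpace ℝ (Fin m) → ℝ}
    (h : ∀ x, φ x = 0 → ψ x = 0) : tsupport ψ ⊆ tsupport φ :=
  closure_mono fun x hx hx0 => hx (h x hx0)

lemma IsTestFunction.comp {φ : EuclideanSpace ℝ (Fin m) → ℝ} (hφ : IsTestFunction Ω φ)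
    {h : ℝ → ℝ} (hh : ContDiff ℝ (∞ : ℕ∞ω) h) (h0 : h 0 = 0) :
    IsTestFunction Ω (fun x => h (φ x)) :=
  ⟨hh.comp hφ.1, hφ.2.1.comp_left h0, 
    (tsupport_mono_of_zero fun x hx0 => by simp [hx0, h0]).trans hφ.2.2⟩

lemma IsTestFunction.mul_smooth {φ ψ : EuclideanSpace ℝ (Fin m) → ℝ} (hφ : IsTestFunction Ω φ)
    (hψ : ContDiff ℝ (∞ : ℕ∞ω) ψ) : IsTestFunction Ω (fun x => φ x * ψ x) :=
  ⟨hφ.1.mul hψ, hφ.2.1.mul_right,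
    (tsupport_mono_of_zero fun x hx0 => by simp [hx0]).trans hφ.2.2⟩

lemma fderiv_comp_apply {φ : EuclideanSpace ℝ (Fin m) → ℝ} {h : ℝ → ℝ}
    (hh : Differentiable ℝ h) (hφ : Differentiable ℝ φ) (x e : EuclideanSpace ℝ (Fin m)) :
    fderiv ℝ (fun x => h (φ x)) x e = deriv h (φ x) * fderiv ℝ φ x e := by
  have h1 : HasFDerivAt (fun x => h (φ x)) _ x :=
    (hh (φ x)).hasDerivAt.comp_hasFDerivAt x (hφ x).hasFDerivAt
  rw [h1.fderiv]
  simp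

lemma gradient_apply (φ : EuclideanSpace ℝ (Fin m) → ℝ) (x : EuclideanSpace ℝ (Fin m))
    (i : Fin m) : gradient φ x i = fderiv ℝ φ x (EuclideanSpace.single i 1) := by
  have h1 : inner ℝ (gradient φ x) (EuclideanSpace.single i 1)
      = fderiv ℝ φ x (EuclideanSpace.single i 1) := by
    rw [gradient, InnerProductSpace.toDual_symm_apply]
  rw [← h1, EuclideanSpace.inner_single_right]
  simp

lemma MemW1p.isWeakGrad {q : ℝ≥0∞} {w : EuclideanSpace ℝ (Fin m) → ℝ} (hw : MemW1p q Ω w) :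
    IsWeakGrad Ω w (weakGrad Ω w) := by
  obtain ⟨-, g, hg, -⟩ := hw
  have h : ∃ g, IsWeakGrad Ω w g := ⟨g, hg⟩
  rw [weakGrad, dif_pos h]
  exact h.choose_spec

lemma ae_eq_of_apply {α : Type*} [MeasurableSpace α] {ν : Measure α}
    {G G' : α → EuclideanSpace ℝ (Fin m)}
    (h : ∀ i, (fun x => G x i) =ᵐ[ν] fun x => G' x i) : G =ᵐ[ν] G' := by
  filter_upwards [ae_all_iff.2 h] with x hx
  ext i
  exact hx i

/-- By uniqueness the chosen representative agrees a.e. with the gradient that witnesses the Sobolev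
membership. -/
lemma MemW1p.weakGrad_memLp (hΩ : IsOpen Ω) {q : ℝ≥0∞} {w : EuclideanSpace ℝ (Fin m) → ℝ}
    (hw : MemW1p q Ω w) : MemLp (weakGrad Ω w) q (volume.restrict Ω) := by
  have h1 := hw.isWeakGrad
  obtain ⟨-, g, hg, hgL⟩ := hw
  exact (memLp_congr_ae (ae_eq_of_apply fun i =>
    (h1.isWeakPartial i).ae_eq hΩ (hg.isWeakPartial i))).2 hgL

lemma memLp_apply {α : Type*} [MeasurableSpace α] {ν : Measure α}
    {G : α → EuclideanSpace ℝ (Fin m)} {q : ℝ≥0∞} (hG : MemLp G q ν) (i : Fin m) :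
    MemLp (fun x => G x i) q ν :=
  hG.of_le ((EuclideanSpace.proj (𝕜 := ℝ) i).continuous.comp_aestronglyMeasurable hG.1)
    (Eventually.of_forall fun x => PiLp.norm_apply_le (G x) i)

/-- Along an a.e. convergent subsequence of the approximating φₖ, the functions h(φₖ) are test
functions because h(0) = 0, they are uniformly bounded, and their gradients h'(φₖ)∇φₖ converge in
L¹. This gains boundedness without leaving the class of functions vanishing on the boundary. -/
lemma MemW1p0.isBoundedTestLimit_comp (hΩ : IsOpen Ω) {w : EuclideanSpace ℝ (Fin m) → ℝ}
    (hw : MemW1p0 1 Ω w) {h : ℝ → ℝ} (hh : ContDiff ℝ (∞ : ℕ∞ω) h) (h0 : h 0 = 0) {C C' : ℝ}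
    (hC : ∀ s, |h s| ≤ C) (hC' : ∀ s, |deriv h s| ≤ C') :
    IsBoundedTestLimit Ω (fun x => h (w x)) (fun x => deriv h (w x) • weakGrad Ω w x) := by
  have hPi : ∀ i, Integrable (fun x => weakGrad Ω w x i) (volume.restrict Ω) := fun i =>
    memLp_one_iff_integrable.1 (memLp_apply (hw.1.weakGrad_memLp hΩ) i)
  have hwm : AEStronglyMeasurable w (volume.restrict Ω) := hw.1.1.1
  have hdc : Continuous (deriv h) := hh.continuous_deriv (by simp)
  obtain ⟨φ, hφ, hl1, hl2⟩ := hw.2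
  have hmeas : TendstoInMeasure (volume.restrict Ω) φ atTop w :=
    tendstoInMeasure_of_tendsto_eLpNorm one_ne_zero
      (fun k => (hφ k).continuous.aestronglyMeasurable) hwm hl1
  obtain ⟨ns, hns, hae⟩ := hmeas.exists_seq_tendsto_ae
  refine ⟨fun i => ?_, fun k x => h (φ (ns k) x), C, fun k => (hφ _).comp hh h0,
    fun k x => hC _, ?_, fun i => ?_⟩
  · exact (hPi i).bdd_mul (hdc.comp_aestronglyMeasurable hwm) (Eventually.of_forall fun x => hC' _)
  · filter_upwards [hae] with x hx
    exact (hh.continuous.tendsto _).comp hx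
  · have hlim : Tendsto (fun k => eLpNorm (fun x => fderiv ℝ (φ (ns k)) x
        (EuclideanSpace.single i 1) - weakGrad Ω w x i) 1 (volume.restrict Ω)) atTop (𝓝 0) := by
      refine tendsto_of_tendsto_of_tendsto_of_le_of_le tendsto_const_nhds
        (hl2.comp hns.tendsto_atTop) (fun _ => zero_le) fun k => ?_
      refine eLpNorm_mono fun x => ?_
      rw [← gradient_apply]
      exact PiLp.norm_apply_le (gradient (φ (ns k)) x - weakGrad Ω w x) i
    have := tendsto_eLpNorm_one_mul (hPi i)
      (fun k => ((hφ (ns k)).continuous_partial _).aestronglyMeasurable) hlim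
      (cn := fun k x => deriv h (φ (ns k) x)) (c := fun x => deriv h (w x)) (C := C')
      (fun k => (hdc.comp (hφ (ns k)).continuous).aestronglyMeasurable)
      (fun k => Eventually.of_forall fun x => hC' _)
      (by filter_upwards [hae] with x hx; exact (hdc.tendsto _).comp hx)
    refine this.congr fun k => ?_
    simp only [fderiv_comp_apply (hh.differentiable (by simp)) ((hφ (ns k)).1.differentiable
      (by simp)), PiLp.smul_apply, smul_eq_mul]

lemma IsBoundedTestLimit.aestronglyMeasurable (hf : IsBoundedTestLimit Ω f p) :
    AEStronglyMeasurable f (volume.restrict Ω) := by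
  obtain ⟨-, φ, C, hφ, -, hae, -⟩ := hf
  exact aestronglyMeasurable_of_tendsto_ae atTop
    (fun k => (hφ k).continuous.aestronglyMeasurable) hae

lemma IsBoundedTestLimit.exists_bound (hf : IsBoundedTestLimit Ω f p) :
    ∃ C, ∀ᵐ x ∂(volume.restrict Ω), |f x| ≤ C := by
  obtain ⟨-, φ, C, hφ, hC, hae, -⟩ := hf
  refine ⟨C, ?_⟩
  filter_upwards [hae] with x hx
  exact le_of_tendsto hx.abs (Eventually.of_forall fun k => hC k x)

/-- Squares of the approximants work; their uniform bound controls the factor 2φₖ in the gradient.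
-/
lemma IsBoundedTestLimit.sq (hf : IsBoundedTestLimit Ω f p) :
    IsBoundedTestLimit Ω (fun x => f x ^ 2) (fun x => (2 * f x) • p x) := by
  obtain ⟨B, hB⟩ := hf.exists_bound
  have hfm := hf.aestronglyMeasurable
  obtain ⟨hp, φ, C, hφ, hC, hae, hd⟩ := hf
  have hC0 : 0 ≤ C := (abs_nonneg _).trans (hC 0 0)
  refine ⟨fun i => ?_, fun k x => φ k x ^ 2, C ^ 2, fun k => ?_, fun k x => ?_, ?_, fun i => ?_⟩
  · refine (hp i).bdd_mul (c := 2 * B) (hfm.const_mul 2) ?_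
    filter_upwards [hB] with x hx
    rw [norm_mul, Real.norm_eq_abs, Real.norm_eq_abs]
    simpa using hx
  · have h := (hφ k).mul_smooth (hφ k).1
    simp only [← pow_two] at h
    exact h
  · rw [abs_pow]
    exact pow_le_pow_left₀ (abs_nonneg _) (hC k x) 2
  · filter_upwards [hae] with x hx
    exact hx.pow 2
  · have := tendsto_eLpNorm_one_mul (hp i)
      (fun k => ((hφ k).continuous_partial _).aestronglyMeasurable) (hd i)
      (cn := fun k x => 2 * φ k x) (c := fun x => 2 * f x) (C := 2 * C)
      (fun k => ((hφ k).continuous.const_mul 2).aestronglyMeasurable)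
      (fun k => Eventually.of_forall fun x => by rw [abs_mul]; simpa using hC k x)
      (by filter_upwards [hae] with x hx; exact hx.const_mul 2)
    refine this.congr fun k => ?_
    have hsq : ∀ x, fderiv ℝ (fun x => φ k x ^ 2) x (EuclideanSpace.single i 1)
        = 2 * φ k x * fderiv ℝ (φ k) x (EuclideanSpace.single i 1) := fun x => by
      rw [fderiv_comp_apply (h := fun s => s ^ 2) (by fun_prop) ((hφ k).1.differentiable (by simp))]
      simp
    simp only [hsq, PiLp.smul_apply, smul_eq_mul]

/-- The product of a bounded limit of test functions with a bounded weakly differentiable function,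
extended by zero, is weakly differentiable on the whole space. -/
lemma IsBoundedTestLimit.isWeakPartial_indicator_mul (hΩ : IsOpen Ω)
    (hΩb : Bornology.IsBounded Ω) (hf : IsBoundedTestLimit Ω f p)
    {b q : EuclideanSpace ℝ (Fin m) → ℝ} {i : Fin m} (hb : IsWeakPartial Ω b i q)
    {B : ℝ} (hB : ∀ x, |b x| ≤ B) (hq : IntegrableOn q Ω) :
    IsWeakPartial Set.univ (Ω.indicator fun x => f x * b x) i
      (Ω.indicator fun x => f x * q x + b x * p x i) := by
  obtain ⟨D, hD⟩ := hf.exists_bound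
  have hfm := hf.aestronglyMeasurable
  have hbm : AEStronglyMeasurable b (volume.restrict Ω) := hb.1.aestronglyMeasurable
  have : IsFiniteMeasure (volume.restrict Ω) := ⟨by simpa using hΩb.measure_lt_top⟩
  have hbi : IntegrableOn b Ω := Integrable.of_bound hbm B (Eventually.of_forall hB)
  obtain ⟨hp, φ, C, hφ, hC, hae, hd⟩ := hf
  have hC0 : 0 ≤ C := (abs_nonneg _).trans (hC 0 0)
  have hfb : IntegrableOn (fun x => f x * b x) Ω := hbi.bdd_mul hfm hD
  have hfq : IntegrableOn (fun x => f x * q x) Ω := hq.bdd_mul hfm hD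
  have hbp : IntegrableOn (fun x => b x * p x i) Ω :=
    (hp i).bdd_mul hbm (Eventually.of_forall hB)
  have hΩm := hΩ.measurableSet
  refine ⟨((integrable_indicator_iff hΩm).2 hfb).locallyIntegrable.locallyIntegrableOn _,
    ((integrable_indicator_iff hΩm).2 (hfq.add hbp)).locallyIntegrable.locallyIntegrableOn _,
    fun ψ hψ => ?_⟩
  set e : EuclideanSpace ℝ (Fin m) := EuclideanSpace.single i 1 with he
  have hψ'c := hψ.continuous_partial e
  obtain ⟨M, hM⟩ := hψ.2.1.exists_bound_of_continuous hψ.continuous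
  obtain ⟨M', hM'⟩ := (hψ.hasCompactSupport_partial e).exists_bound_of_continuous hψ'c
  have hM0 : 0 ≤ M := (norm_nonneg _).trans (hM 0)
  have hM'0 : 0 ≤ M' := (norm_nonneg _).trans (hM' 0)
  have hB0 : 0 ≤ B := (abs_nonneg _).trans (hB 0)
  have l1 : Tendsto (fun k => ∫ x in Ω, (φ k x * fderiv ℝ ψ x e) * b x) atTop
      (𝓝 (∫ x in Ω, (f x * fderiv ℝ ψ x e) * b x)) := by
    refine tendsto_integral_mul_of_tendsto (C := C * M') hbi (fun _ => hbi) (by simp)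
      (fun k => ((hφ k).continuous.mul hψ'c).aestronglyMeasurable)
      (fun k => Eventually.of_forall fun x => ?_) ?_
    · rw [abs_mul]
      exact mul_le_mul (hC k x) (hM' x) (abs_nonneg _) hC0
    · filter_upwards [hae] with x hx
      exact hx.mul_const _
  have l2 : Tendsto (fun k => ∫ x in Ω, (b x * ψ x) * fderiv ℝ (φ k) x e) atTop
      (𝓝 (∫ x in Ω, (b x * ψ x) * p x i)) := by
    refine tendsto_integral_mul_of_tendsto (C := B * M) (hp i) (fun k => ?_) (hd i)
      (fun k => hbm.mul hψ.continuous.aestronglyMeasurable)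
      (fun k => Eventually.of_forall fun x => ?_) (Eventually.of_forall fun x => tendsto_const_nhds)
    · exact (((hφ k).continuous_partial e).integrable_of_hasCompactSupport
        ((hφ k).hasCompactSupport_partial e)).integrableOn
    · rw [abs_mul]
      exact mul_le_mul (hB x) (hM x) (abs_nonneg _) hB0
  have l3 : Tendsto (fun k => ∫ x in Ω, (φ k x * ψ x) * q x) atTop
      (𝓝 (∫ x in Ω, (f x * ψ x) * q x)) := by
    refine tendsto_integral_mul_of_tendsto (C := C * M) hq (fun _ => hq) (by simp)
      (fun k => ((hφ k).continuous.mul hψ.continuous).aestronglyMeasurable)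
      (fun k => Eventually.of_forall fun x => ?_) ?_
    · rw [abs_mul]
      exact mul_le_mul (hC k x) (hM x) (abs_nonneg _) hC0
    · filter_upwards [hae] with x hx
      exact hx.mul_const _
  -- Here ψ need not be supported in Ω, but φₖψ is a test function in Ω. Testing the weak derivative
  -- of b with it produces no boundary term.
  have hk : ∀ k, (∫ x in Ω, (φ k x * fderiv ℝ ψ x e) * b x)
      + ∫ x in Ω, (b x * ψ x) * fderiv ℝ (φ k) x e = - ∫ x in Ω, (φ k x * ψ x) * q x := by
    intro k
    have hT : IsTestFunction Ω (fun x => φ k x * ψ x) := (hφ k).mul_smooth hψ.1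
    have h1 := hb.2.2 _ hT
    have h2 : ∀ x, fderiv ℝ (fun x => φ k x * ψ x) x e
        = φ k x * fderiv ℝ ψ x e + ψ x * fderiv ℝ (φ k) x e := fun x => by
      have h3 : HasFDerivAt (fun x => φ k x * ψ x) _ x :=
        ((hφ k).1.differentiable (by simp) x).hasFDerivAt.mul
          (hψ.1.differentiable (by simp) x).hasFDerivAt
      rw [h3.fderiv]
      simp
    rw [← he] at h1
    have hi1 : Integrable (fun x => (φ k x * fderiv ℝ ψ x e) * b x) (volume.restrict Ω) :=
      hbi.bdd_mul (c := C * M') ((hφ k).continuous.mul hψ'c).aestronglyMeasurable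
        (Eventually.of_forall fun x => by
          rw [norm_mul]; exact mul_le_mul (hC k x) (hM' x) (abs_nonneg _) hC0)
    have hi2 : Integrable (fun x => (b x * ψ x) * fderiv ℝ (φ k) x e) (volume.restrict Ω) :=
      (((hφ k).continuous_partial e).integrable_of_hasCompactSupport
        ((hφ k).hasCompactSupport_partial e)).integrableOn.bdd_mul (c := B * M)
        (hbm.mul hψ.continuous.aestronglyMeasurable)
        (Eventually.of_forall fun x => by
          simp only [norm_mul]; exact mul_le_mul (hB x) (hM x) (abs_nonneg _) hB0)
    rw [← integral_add hi1 hi2]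
    refine Eq.trans ?_ (h1.trans (congrArg Neg.neg ?_))
    · refine integral_congr_ae (Eventually.of_forall fun x => ?_)
      simp only [h2]
      ring
    · simp only [mul_comm]
  have hlim := tendsto_nhds_unique (l1.add l2) (l3.neg.congr fun k => (hk k).symm)
  have hind : ∀ F ψ' : EuclideanSpace ℝ (Fin m) → ℝ,
      ∫ x in Set.univ, Ω.indicator F x * ψ' x = ∫ x in Ω, F x * ψ' x := by
    intro F ψ'
    rw [Measure.restrict_univ, ← integral_indicator hΩm]
    congr 1
    ext x
    by_cases hx : x ∈ Ω <;> simp [hx]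
  have hψbd : ∀ G : EuclideanSpace ℝ (Fin m) → ℝ, IntegrableOn G Ω →
      IntegrableOn (fun x => G x * ψ x) Ω := fun G hG =>
    Integrable.mul_bdd hG hψ.continuous.aestronglyMeasurable (Eventually.of_forall hM)
  rw [hind, hind]
  simp only [add_mul]
  rw [integral_add (hψbd _ hfq) (hψbd _ hbp)]
  have e1 : ∫ x in Ω, f x * b x * fderiv ℝ ψ x e = ∫ x in Ω, (f x * fderiv ℝ ψ x e) * b x :=
    integral_congr_ae (Eventually.of_forall fun x => by simp only; ring)
  have e2 : ∫ x in Ω, b x * p x i * ψ x = ∫ x in Ω, (b x * ψ x) * p x i :=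
    integral_congr_ae (Eventually.of_forall fun x => by simp only; ring)
  have e3 : ∫ x in Ω, f x * q x * ψ x = ∫ x in Ω, (f x * ψ x) * q x :=
    integral_congr_ae (Eventually.of_forall fun x => by simp only; ring)
  rw [e1, e2, e3]
  linarith

lemma exists_testFunction_eq_one (hΩb : Bornology.IsBounded Ω) :
    ∃ ψ : EuclideanSpace ℝ (Fin m) → ℝ, IsTestFunction Set.univ ψ ∧ ∀ x ∈ Ω, ψ x = 1 := by
  obtain ⟨R, hR⟩ := hΩb.subset_closedBall 0
  let ρ : ContDiffBump (0 : EuclideanSpace ℝ (Fin m)) :=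
    ⟨max R 1, max R 1 + 1, by positivity, by linarith⟩
  exact ⟨ρ, ⟨ρ.contDiff, ρ.hasCompactSupport, Set.subset_univ _⟩, fun x hx =>
    ρ.one_of_mem_closedBall (Metric.closedBall_subset_closedBall (le_max_left _ _) (hR hx))⟩

/-- The zero extension of fb is tested against a cutoff equal to 1 on Ω, whose derivative therefore
vanishes on the open set Ω. -/
lemma IsBoundedTestLimit.integral_eq_zero_of_bounded (hΩ : IsOpen Ω)
    (hΩb : Bornology.IsBounded Ω) (hf : IsBoundedTestLimit Ω f p)
    {b q : EuclideanSpace ℝ (Fin m) → ℝ} {i : Fin m} (hb : IsWeakPartial Ω b i q)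
    {B : ℝ} (hB : ∀ x, |b x| ≤ B) (hq : IntegrableOn q Ω) :
    ∫ x in Ω, (f x * q x + b x * p x i) = 0 := by
  obtain ⟨ψ, hψ, hψ1⟩ := exists_testFunction_eq_one hΩb
  have h := (hf.isWeakPartial_indicator_mul hΩ hΩb hb hB hq).2.2 ψ hψ
  have h1 : ∀ x, Ω.indicator (fun x => f x * b x) x * fderiv ℝ ψ x (EuclideanSpace.single i 1)
      = 0 := by
    intro x
    by_cases hx : x ∈ Ω
    · have : ψ =ᶠ[𝓝 x] fun _ => 1 := by
        filter_upwards [hΩ.mem_nhds hx] with y hy using hψ1 y hy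
      rw [this.fderiv_eq]
      simp
    · simp [hx]
  have h2 : ∀ x, Ω.indicator (fun x => f x * q x + b x * p x i) x * ψ x
      = Ω.indicator (fun x => f x * q x + b x * p x i) x := by
    intro x
    by_cases hx : x ∈ Ω
    · rw [hψ1 x hx, mul_one]
    · simp [hx]
  simp only [h1, h2, integral_zero, Measure.restrict_univ] at h
  rw [integral_indicator hΩ.measurableSet] at h
  linarith

end TestLimits

/-! ### Smooth bounded truncations of unbounded functions. -/

section Truncation

/-- Smooth truncation at height of order `n`. -/
noncomputable def smoothTrunc (n : ℕ) (s : ℝ) : ℝ := (n + 1) * Real.arctan (s / (n + 1))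

lemma contDiff_smoothTrunc (n : ℕ) : ContDiff ℝ 1 (smoothTrunc n) :=
  contDiff_const.mul (Real.contDiff_arctan.comp (contDiff_id.div_const _))

lemma deriv_smoothTrunc (n : ℕ) (s : ℝ) :
    deriv (smoothTrunc n) s = 1 / (1 + (s / (n + 1)) ^ 2) := by
  have hn : (n : ℝ) + 1 ≠ 0 := by positivity
  have h1 : HasDerivAt (smoothTrunc n) _ s :=
    (((hasDerivAt_id s).div_const ((n : ℝ) + 1)).arctan).const_mul ((n : ℝ) + 1)
  rw [h1.deriv]
  simp only [id]
  field_simp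

lemma abs_deriv_smoothTrunc_le (n : ℕ) (s : ℝ) : |deriv (smoothTrunc n) s| ≤ 1 := by
  rw [deriv_smoothTrunc, abs_of_nonneg (by positivity)]
  exact div_le_one_of_le₀ (by nlinarith [sq_nonneg (s / ((n : ℝ) + 1))]) (by positivity)

lemma abs_smoothTrunc_le (n : ℕ) (s : ℝ) : |smoothTrunc n s| ≤ (n + 1) * (Real.pi / 2) := by
  rw [smoothTrunc, abs_mul, abs_of_nonneg (by positivity)]
  gcongr
  exact abs_le.2 ⟨(Real.neg_pi_div_two_lt_arctan _).le, (Real.arctan_lt_pi_div_two _).le⟩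

lemma abs_smoothTrunc_le_abs (n : ℕ) (s : ℝ) : |smoothTrunc n s| ≤ |s| := by
  have h := abs_sub_le_of_abs_deriv_le ((contDiff_smoothTrunc n).differentiable one_ne_zero)
    (abs_deriv_smoothTrunc_le n) s 0
  simpa [smoothTrunc] using h

lemma tendsto_div_natCast_add_one (s : ℝ) :
    Tendsto (fun n : ℕ => s / ((n : ℝ) + 1)) atTop (𝓝 0) := by
  simpa [div_eq_mul_inv] using
    (tendsto_one_div_add_atTop_nhds_zero_nat (𝕜 := ℝ)).const_mul s

lemma tendsto_deriv_smoothTrunc (s : ℝ) :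
    Tendsto (fun n => deriv (smoothTrunc n) s) atTop (𝓝 1) := by
  simp only [deriv_smoothTrunc]
  have := (tendsto_const_nhds (x := (1 : ℝ))).div
    (((tendsto_div_natCast_add_one s).pow 2).const_add 1) (by simp)
  simpa [Pi.div_def] using this

lemma tendsto_smoothTrunc (s : ℝ) : Tendsto (fun n => smoothTrunc n s) atTop (𝓝 s) := by
  rcases eq_or_ne s 0 with rfl | hs
  · simp [smoothTrunc]
  -- For s ≠ 0 the truncation is s times a difference quotient of arctan at 0 with increment s/(n +
  -- 1), and arctan'(0) = 1.
  have h1 := hasDerivAt_iff_tendsto_slope_zero.1 (Real.hasDerivAt_arctan 0)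
  have h2 : Tendsto (fun n : ℕ => s / ((n : ℝ) + 1)) atTop (𝓝[≠] 0) :=
    tendsto_nhdsWithin_iff.2 ⟨tendsto_div_natCast_add_one s, Eventually.of_forall fun n =>
      div_ne_zero hs (by positivity)⟩
  have h3 := (h1.comp h2).const_mul s
  simp only [Function.comp_def, smul_eq_mul, zero_add, Real.arctan_zero, sub_zero] at h3
  refine (h3.congr fun n => ?_).trans (by simp)
  rw [smoothTrunc]
  field_simp

end Truncation

/-! ### Integration by parts for unbounded W^{1,2} factors. -/

section TestLimits

variable {m : ℕ} {Ω : Set (EuclideanSpace ℝ (Fin m))} {f : EuclideanSpace ℝ (Fin m) → ℝ}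
  {p : EuclideanSpace ℝ (Fin m) → EuclideanSpace ℝ (Fin m)}

lemma integrableOn_of_memLp_two (hΩb : Bornology.IsBounded Ω)
    {q : EuclideanSpace ℝ (Fin m) → ℝ} (hq : MemLp q 2 (volume.restrict Ω)) :
    IntegrableOn q Ω := by
  have : IsFiniteMeasure (volume.restrict Ω) := ⟨by simpa using hΩb.measure_lt_top⟩
  exact hq.integrable (by norm_num)

lemma IsWeakPartial.smoothTrunc (hΩ : IsOpen Ω) {b q : EuclideanSpace ℝ (Fin m) → ℝ} {i : Fin m}
    (hb : IsWeakPartial Ω b i q) (n : ℕ) :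
    IsWeakPartial Ω (fun x => HeisenbergGraph.smoothTrunc n (b x)) i
      (fun x => deriv (HeisenbergGraph.smoothTrunc n) (b x) * q x) :=
  hb.comp hΩ (contDiff_smoothTrunc n) (abs_deriv_smoothTrunc_le n)

lemma memLp_deriv_smoothTrunc_mul {b q : EuclideanSpace ℝ (Fin m) → ℝ}
    (hbm : AEStronglyMeasurable b (volume.restrict Ω)) (hq : MemLp q 2 (volume.restrict Ω))
    (n : ℕ) : MemLp (fun x => deriv (smoothTrunc n) (b x) * q x) 2 (volume.restrict Ω) := by
  refine hq.of_le ((((contDiff_smoothTrunc n).continuous_deriv le_rfl).comp_aestronglyMeasurable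
    hbm).mul hq.1) (Eventually.of_forall fun x => ?_)
  rw [norm_mul]
  exact mul_le_of_le_one_left (norm_nonneg _) (abs_deriv_smoothTrunc_le n _)

/-- Integration by parts against `W^{1,2}` functions. -/
lemma IsBoundedTestLimit.integral_eq_zero (hΩ : IsOpen Ω)
    (hΩb : Bornology.IsBounded Ω) (hf : IsBoundedTestLimit Ω f p)
    {b q : EuclideanSpace ℝ (Fin m) → ℝ} {i : Fin m} (hb : IsWeakPartial Ω b i q)
    (hpL : MemLp (fun x => p x i) 2 (volume.restrict Ω)) (hbL : MemLp b 2 (volume.restrict Ω))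
    (hqL : MemLp q 2 (volume.restrict Ω)) :
    ∫ x in Ω, (f x * q x + b x * p x i) = 0 := by
  obtain ⟨C, hC⟩ := hf.exists_bound
  have hfm := hf.aestronglyMeasurable
  have hqi := integrableOn_of_memLp_two hΩb hqL
  have hz : ∀ n, ∫ x in Ω, (f x * (deriv (smoothTrunc n) (b x) * q x)
      + smoothTrunc n (b x) * p x i) = 0 := fun n =>
    hf.integral_eq_zero_of_bounded hΩ hΩb (hb.smoothTrunc hΩ n) (fun x => abs_smoothTrunc_le n _)
      (integrableOn_of_memLp_two hΩb (memLp_deriv_smoothTrunc_mul hbL.1 hqL n))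
  -- Truncating b shrinks both b and its derivative pointwise, so |fq| is dominated through the
  -- bound on f, and |bp| by a product of two L² functions.
  refine tendsto_nhds_unique (tendsto_integral_of_dominated_convergence
    (fun x => C * ‖q x‖ + ‖b x * p x i‖) (fun n => ?_) ?_ (fun n => ?_) ?_)
    (tendsto_const_nhds.congr fun n => (hz n).symm)
  · exact (hfm.mul (memLp_deriv_smoothTrunc_mul hbL.1 hqL n).1).add
      (((contDiff_smoothTrunc n).continuous.comp_aestronglyMeasurable hbL.1).mul hpL.1)
  · exact (hqi.norm.const_mul C).add (hbL.integrable_mul hpL).norm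
  · filter_upwards [hC] with x hx
    refine (norm_add_le _ _).trans (add_le_add ?_ ?_)
    · rw [norm_mul, norm_mul]
      refine mul_le_mul hx ?_ (by positivity) ((abs_nonneg _).trans hx)
      exact mul_le_of_le_one_left (norm_nonneg _) (abs_deriv_smoothTrunc_le n _)
    · rw [norm_mul, norm_mul]
      exact mul_le_mul_of_nonneg_right (abs_smoothTrunc_le_abs n _) (norm_nonneg _)
  · refine Eventually.of_forall fun x => ?_
    have h1 := ((tendsto_deriv_smoothTrunc (b x)).mul_const (q x)).const_mul (f x)
    rw [one_mul] at h1
    exact h1.add ((tendsto_smoothTrunc (b x)).mul_const _)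

end TestLimits

/-! ### Symmetry of mixed derivatives in weak form. -/

section MixedPartials

variable {m : ℕ} {Ω : Set (EuclideanSpace ℝ (Fin m))}

lemma tendsto_integral_mul_of_tendsto_eLpNorm_two {α : Type*} [MeasurableSpace α] {ν : Measure α}
    {a z : α → ℝ} {an : ℕ → α → ℝ} (hz : MemLp z 2 ν) (ha : MemLp a 2 ν)
    (han : ∀ n, AEStronglyMeasurable (an n) ν)
    (hlim : Tendsto (fun n => eLpNorm (fun x => an n x - a x) 2 ν) atTop (𝓝 0)) :
    Tendsto (fun n => ∫ x, z x * an n x ∂ν) atTop (𝓝 (∫ x, z x * a x ∂ν)) := by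
  have hlim1 : Tendsto (fun n => eLpNorm (fun x => z x * an n x - z x * a x) 1 ν) atTop
      (𝓝 0) := by
    have h := ENNReal.Tendsto.const_mul hlim (a := eLpNorm z 2 ν) (Or.inr hz.2.ne)
    rw [mul_zero] at h
    refine tendsto_of_tendsto_of_tendsto_of_le_of_le tendsto_const_nhds h
      (fun _ => zero_le) fun n => ?_
    have := eLpNorm_smul_le_mul_eLpNorm (p := 2) (q := 2) (r := 1)
      ((han n).sub ha.1) hz.1
    refine le_trans (le_of_eq (congrArg (fun F => eLpNorm F 1 ν) ?_)) this
    ext x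
    simp [mul_sub]
  have hint : ∀ᶠ n in atTop, Integrable (fun x => z x * an n x) ν := by
    -- The approximants are only assumed measurable; convergence puts their differences from the
    -- limit in L² for large n.
    filter_upwards [ENNReal.tendsto_nhds_zero.1 hlim 1 one_pos] with n hn
    have h1 : MemLp (fun x => an n x - a x) 2 ν :=
      ⟨(han n).sub ha.1, hn.trans_lt ENNReal.one_lt_top⟩
    have h2 := hz.integrable_mul (h1.add ha)
    refine h2.congr (Eventually.of_forall fun x => ?_)
    simp
  exact tendsto_integral_of_L1' _ (hz.integrable_mul ha).1 hint hlim1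

lemma fderiv_fderiv_comm {φ : EuclideanSpace ℝ (Fin m) → ℝ} (hφ : ContDiff ℝ (∞ : ℕ∞ω) φ)
    (x e e' : EuclideanSpace ℝ (Fin m)) :
    fderiv ℝ (fun y => fderiv ℝ φ y e) x e' = fderiv ℝ (fun y => fderiv ℝ φ y e') x e := by
  have h2 : (2 : ℕ∞ω) ≤ (∞ : ℕ∞ω) := WithTop.coe_le_coe.2 (le_top : (2 : ℕ∞) ≤ ⊤)
  have hd : DifferentiableAt ℝ (fderiv ℝ φ) x :=
    (hφ.fderiv_right (m := 1) (one_add_one_eq_two.le.trans h2)).differentiable one_ne_zero x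
  have h1 : ∀ e e', fderiv ℝ (fun y => fderiv ℝ φ y e) x e' = fderiv ℝ (fderiv ℝ φ) x e' e := by
    intro e e'
    rw [(hd.hasFDerivAt.clm_apply (hasFDerivAt_const e x)).fderiv]
    simp
  rw [h1, h1]
  exact (hφ.contDiffAt.isSymmSndFDerivAt (by simpa using h2)).eq _ _

lemma isTestFunction_univ_partial {φ : EuclideanSpace ℝ (Fin m) → ℝ}
    (hφ : IsTestFunction Set.univ φ) (e : EuclideanSpace ℝ (Fin m)) :
    IsTestFunction Set.univ (fun x => fderiv ℝ φ x e) :=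
  ⟨(hφ.1.fderiv_right (m := (∞ : ℕ∞ω)) (by simp)).clm_apply contDiff_const,
    hφ.hasCompactSupport_partial e, Set.subset_univ _⟩

/-- Weak form of the symmetry of mixed second derivatives. -/
lemma IsWeakPartial.integral_mul_comm {y z : EuclideanSpace ℝ (Fin m) → ℝ}
    {dy dz : Fin m → EuclideanSpace ℝ (Fin m) → ℝ} (hyc : HasCompactSupport y)
    (hyi : Integrable y)
    (hy : ∀ i, IsWeakPartial Set.univ y i (dy i)) (hz : ∀ i, IsWeakPartial Set.univ z i (dz i))
    (hdy : ∀ i, MemLp (dy i) 2 volume) (hdz : ∀ i, MemLp (dz i) 2 volume) (i j : Fin m) :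
    ∫ x, dz i x * dy j x = ∫ x, dz j x * dy i x := by
  obtain ⟨ρ, hρ, -⟩ := exists_contDiffBump_seq (E := EuclideanSpace ℝ (Fin m))
  -- Only y is smoothed: ∫ ∂ᵢz ∂ⱼY = -∫ z ∂ᵢ∂ⱼY is symmetric in i and j by the classical theorem,
  -- and ∇Y converges to ∇y in L².
  let Y : ℕ → EuclideanSpace ℝ (Fin m) → ℝ := fun n => mollify volume (ρ n) y
  have hY : ∀ n, IsTestFunction Set.univ (Y n) := fun n =>
    ⟨contDiff_mollify _ hyi.locallyIntegrable,
      HasCompactSupport.convolution _ (ρ n).hasCompactSupport_normed hyc, Set.subset_univ _⟩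
  have hdY : ∀ n i x, fderiv ℝ (Y n) x (EuclideanSpace.single i 1)
      = mollify volume (ρ n) (dy i) x := by
    intro n i x
    have := fderiv_mollify_apply (K' := Set.univ) subset_rfl MeasurableSet.univ hyi.integrableOn
      (hy i) (ρ n) (x := x) (Set.subset_univ _)
    simpa only [Set.indicator_univ] using this
  have hlim : ∀ i j, Tendsto (fun n => ∫ x, dz i x * fderiv ℝ (Y n) x (EuclideanSpace.single j 1))
      atTop (𝓝 (∫ x, dz i x * dy j x)) := fun i j =>
    tendsto_integral_mul_of_tendsto_eLpNorm_two (hdz i) (hdy j)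
      (fun n => ((hY n).continuous_partial _).aestronglyMeasurable)
      (by
        simp only [hdY]
        exact tendsto_eLpNorm_mollify_sub (by norm_num) (by norm_num) (hdy j) hρ)
  have heq : ∀ n, ∫ x, dz i x * fderiv ℝ (Y n) x (EuclideanSpace.single j 1)
      = ∫ x, dz j x * fderiv ℝ (Y n) x (EuclideanSpace.single i 1) := by
    intro n
    have h1 := (hz i).2.2 _ (isTestFunction_univ_partial (hY n) (EuclideanSpace.single j 1))
    have h2 := (hz j).2.2 _ (isTestFunction_univ_partial (hY n) (EuclideanSpace.single i 1))
    simp only [fderiv_fderiv_comm (hY n).1 _ (EuclideanSpace.single j 1)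
      (EuclideanSpace.single i 1)] at h1
    rw [h2] at h1
    simpa using h1.symm
  exact tendsto_nhds_unique (hlim i j) ((hlim j i).congr fun n => (heq n).symm)

variable {f : EuclideanSpace ℝ (Fin m) → ℝ}
  {p : EuclideanSpace ℝ (Fin m) → EuclideanSpace ℝ (Fin m)}

lemma integral_indicator_mul_indicator (hΩ : MeasurableSet Ω)
    (a b : EuclideanSpace ℝ (Fin m) → ℝ) :
    ∫ x, Ω.indicator a x * Ω.indicator b x = ∫ x in Ω, a x * b x := by
  rw [← integral_indicator hΩ]
  congr 1
  ext x
  by_cases hx : x ∈ Ω <;> simp [hx]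

/-- The function b need not extend across the boundary of Ω, but f and fb extend by zero. Symmetry
for the pair z = fb, y = f gives the claim, since the extra term b pᵢpⱼ from ∂ᵢz ∂ⱼy is itself
symmetric and cancels. -/
lemma IsBoundedTestLimit.integral_partial_comm_of_bounded (hΩ : IsOpen Ω)
    (hΩb : Bornology.IsBounded Ω) (hf : IsBoundedTestLimit Ω f p)
    (hpL : ∀ i, MemLp (fun x => p x i) 2 (volume.restrict Ω))
    {b : EuclideanSpace ℝ (Fin m) → ℝ} {q : Fin m → EuclideanSpace ℝ (Fin m) → ℝ}
    (hb : ∀ i, IsWeakPartial Ω b i (q i)) {B : ℝ} (hB : ∀ x, |b x| ≤ B)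
    (hqL : ∀ i, MemLp (q i) 2 (volume.restrict Ω)) (i j : Fin m) :
    ∫ x in Ω, f x * (q i x * p x j) = ∫ x in Ω, f x * (q j x * p x i) := by
  have hΩm := hΩ.measurableSet
  obtain ⟨D, hD⟩ := hf.exists_bound
  have hfm := hf.aestronglyMeasurable
  have : IsFiniteMeasure (volume.restrict Ω) := ⟨by simpa using hΩb.measure_lt_top⟩
  have hfi : IntegrableOn f Ω := Integrable.of_bound hfm D hD
  have hbm : AEStronglyMeasurable b (volume.restrict Ω) := (hb i).1.aestronglyMeasurable
  -- Taking b = 1 in the product lemma yields the zero extension of f itself.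
  have hone : ∀ i, IsWeakPartial Ω (fun _ => (1 : ℝ)) i (fun _ => 0) := fun i => by
    have h := (hb i).comp hΩ (h := fun _ => (1 : ℝ)) contDiff_const (C := 0) (by simp)
    simpa using h
  have hy : ∀ i, IsWeakPartial Set.univ (Ω.indicator f) i (Ω.indicator fun x => p x i) :=
    fun i => by
      have h := hf.isWeakPartial_indicator_mul hΩ hΩb (hone i) (B := 1) (by simp)
        integrableOn_zero
      simpa using h
  have hz : ∀ i, IsWeakPartial Set.univ (Ω.indicator fun x => f x * b x) i
      (Ω.indicator fun x => f x * q i x + b x * p x i) := fun i =>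
    hf.isWeakPartial_indicator_mul hΩ hΩb (hb i) hB (integrableOn_of_memLp_two hΩb (hqL i))
  have hzL : ∀ i, MemLp (fun x => f x * q i x + b x * p x i) 2 (volume.restrict Ω) := fun i =>
    ((hqL i).of_le_mul (c := D) (hfm.mul (hqL i).1) (by
      filter_upwards [hD] with x hx
      rw [Pi.mul_apply, norm_mul]
      exact mul_le_mul_of_nonneg_right hx (norm_nonneg _))).add
    ((hpL i).of_le_mul (c := B) (hbm.mul (hpL i).1) (Eventually.of_forall fun x => by
      rw [norm_mul]
      exact mul_le_mul_of_nonneg_right (hB x) (norm_nonneg _)))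
  have hc : HasCompactSupport (Ω.indicator f) :=
    HasCompactSupport.of_support_subset_isCompact hΩb.isCompact_closure
      ((Set.support_indicator_subset).trans subset_closure)
  have key := IsWeakPartial.integral_mul_comm hc ((integrable_indicator_iff hΩm).2 hfi) hy hz
    (fun i => (memLp_indicator_iff_restrict hΩm).2 (hpL i))
    (fun i => (memLp_indicator_iff_restrict hΩm).2 (hzL i)) i j
  rw [integral_indicator_mul_indicator hΩm, integral_indicator_mul_indicator hΩm] at key
  have hi1 : ∀ i j, Integrable (fun x => f x * (q i x * p x j)) (volume.restrict Ω) := fun i j =>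
    ((hqL i).integrable_mul (hpL j)).bdd_mul hfm hD
  have hi2 : ∀ i j, Integrable (fun x => b x * (p x i * p x j)) (volume.restrict Ω) := fun i j =>
    ((hpL i).integrable_mul (hpL j)).bdd_mul hbm (Eventually.of_forall hB)
  have hsplit : ∀ i j, ∫ x in Ω, (f x * q i x + b x * p x i) * p x j
      = (∫ x in Ω, f x * (q i x * p x j)) + ∫ x in Ω, b x * (p x i * p x j) := fun i j => by
    rw [← integral_add (hi1 i j) (hi2 i j)]
    refine integral_congr_ae (Eventually.of_forall fun x => ?_)
    simp only
    ring
  rw [hsplit, hsplit] at key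
  have hsymm : ∫ x in Ω, b x * (p x i * p x j) = ∫ x in Ω, b x * (p x j * p x i) := by
    simp only [mul_comm]
  rw [hsymm] at key
  exact add_right_cancel key

lemma IsBoundedTestLimit.integral_partial_comm (hΩ : IsOpen Ω)
    (hΩb : Bornology.IsBounded Ω) (hf : IsBoundedTestLimit Ω f p)
    (hpL : ∀ i, MemLp (fun x => p x i) 2 (volume.restrict Ω))
    {b : EuclideanSpace ℝ (Fin m) → ℝ} {q : Fin m → EuclideanSpace ℝ (Fin m) → ℝ}
    (hb : ∀ i, IsWeakPartial Ω b i (q i))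
    (hqL : ∀ i, MemLp (q i) 2 (volume.restrict Ω)) (i j : Fin m) :
    ∫ x in Ω, f x * (q i x * p x j) = ∫ x in Ω, f x * (q j x * p x i) := by
  obtain ⟨D, hD⟩ := hf.exists_bound
  have hfm := hf.aestronglyMeasurable
  have hbm : AEStronglyMeasurable b (volume.restrict Ω) := (hb i).1.aestronglyMeasurable
  have hn := fun n => hf.integral_partial_comm_of_bounded hΩ hΩb hpL
    (fun i => (hb i).smoothTrunc hΩ n) (fun x => abs_smoothTrunc_le n _)
    (fun i => memLp_deriv_smoothTrunc_mul hbm (hqL i) n) i j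
  have hlim : ∀ i j, Tendsto (fun n => ∫ x in Ω, f x * ((deriv (smoothTrunc n) (b x) * q i x)
      * p x j)) atTop (𝓝 (∫ x in Ω, f x * (q i x * p x j))) := by
    intro i j
    refine tendsto_integral_of_dominated_convergence (fun x => D * ‖q i x * p x j‖)
      (fun n => hfm.mul ((memLp_deriv_smoothTrunc_mul hbm (hqL i) n).1.mul (hpL j).1))
      (((hqL i).integrable_mul (hpL j)).norm.const_mul D) (fun n => ?_)
      (Eventually.of_forall fun x => ?_)
    · filter_upwards [hD] with x hx
      rw [norm_mul, mul_assoc, norm_mul (deriv _ _)]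
      refine mul_le_mul hx ?_ (by positivity) ((abs_nonneg _).trans hx)
      exact mul_le_of_le_one_left (norm_nonneg _) (abs_deriv_smoothTrunc_le n _)
    · have h1 := (((tendsto_deriv_smoothTrunc (b x)).mul_const (q i x)).mul_const
        (p x j)).const_mul (f x)
      rwa [one_mul] at h1
  exact tendsto_nhds_unique (hlim i j) ((hlim j i).congr fun n => (hn n).symm)

end MixedPartials

/-! ### Algebra of the star operation. -/

section Star

variable {n : ℕ}

/-- The involution exchanging `2k` and `2k + 1`. -/
def pairSwap (i : Fin (2 * n)) : Fin (2 * n) :=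
  if h : i.1 % 2 = 0 then ⟨i.1 + 1, by omega⟩ else ⟨i.1 - 1, by omega⟩

/-- The sign of the `i`-th coordinate in `starVec`. -/
def pairSign (i : Fin (2 * n)) : ℝ := if i.1 % 2 = 0 then 1 else -1

lemma starVec_apply (g : EuclideanSpace ℝ (Fin (2 * n))) (i : Fin (2 * n)) :
    starVec g i = pairSign i * g (pairSwap i) := by
  simp only [starVec, pairSign, pairSwap]
  split_ifs <;> simp

lemma pairSwap_involutive : Function.Involutive (pairSwap (n := n)) := by
  intro i
  ext
  by_cases h : i.1 % 2 = 0
  · have h2 : ¬ (i.1 + 1) % 2 = 0 := by omega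
    simp [pairSwap, h, h2]
  · have h2 : (i.1 - 1) % 2 = 0 := by omega
    simp [pairSwap, h, h2]
    omega

lemma pairSign_pairSwap (i : Fin (2 * n)) : pairSign (pairSwap i) = - pairSign i := by
  by_cases h : i.1 % 2 = 0
  · have h2 : ¬ (i.1 + 1) % 2 = 0 := by omega
    simp [pairSwap, pairSign, h, h2]
  · have h2 : (i.1 - 1) % 2 = 0 := by omega
    simp [pairSwap, pairSign, h, h2]

/-- Reindexing by the swap flips the sign and transposes T, so the sum equals its own negative. It
serves both g · g* = 0 and the vanishing of ∫ f ∇f · (∇v)*. -/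
lemma sum_pairSign_mul_eq_zero {T : Fin (2 * n) → Fin (2 * n) → ℝ} (hT : ∀ i j, T i j = T j i) :
    ∑ i, pairSign i * T (pairSwap i) i = 0 := by
  have h := Equiv.sum_comp pairSwap_involutive.toPerm
    (fun i => pairSign i * T (pairSwap i) i)
  simp only [Function.Involutive.coe_toPerm, pairSign_pairSwap, pairSwap_involutive _] at h
  have h2 : ∑ i, -pairSign i * T i (pairSwap i) = - ∑ i, pairSign i * T (pairSwap i) i := by
    rw [← Finset.sum_neg_distrib]
    exact Finset.sum_congr rfl fun i _ => by rw [hT]; ring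
  linarith

lemma sum_mul_starVec_self (g : EuclideanSpace ℝ (Fin (2 * n))) :
    ∑ i, g i * starVec g i = 0 := by
  rw [← sum_pairSign_mul_eq_zero (T := fun i j => g i * g j) fun i j => mul_comm _ _]
  exact Finset.sum_congr rfl fun i _ => by rw [starVec_apply]; ring

/-- The hypothesis gives |b|(a - b) = (|a| - |b|) b, which is orthogonal to b*. -/
lemma sum_sub_mul_starVec_eq_zero {a b : EuclideanSpace ℝ (Fin (2 * n))}
    (h : ‖b‖ • a = ‖a‖ • b) : ∑ i, (a - b) i * starVec b i = 0 := by
  rcases eq_or_ne b 0 with rfl | hb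
  · exact Finset.sum_eq_zero fun i _ => by simp [starVec_apply]
  have hb' : ‖b‖ ≠ 0 := norm_ne_zero_iff.2 hb
  have key : ‖b‖ * ∑ i, (a - b) i * starVec b i = (‖a‖ - ‖b‖) * ∑ i, b i * starVec b i := by
    rw [Finset.mul_sum, Finset.mul_sum]
    refine Finset.sum_congr rfl fun i _ => ?_
    have hi : ‖b‖ * a i = ‖a‖ * b i := by simpa using congrArg (fun v => v i) h
    simp only [PiLp.sub_apply]
    linear_combination (starVec b i) * hi
  rw [sum_mul_starVec_self, mul_zero] at key
  exact (mul_eq_zero.1 key).resolve_left hb'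

end Star

/-! ### The equality case of the weak inequality. -/

section Comparison

lemma inner_normalized_self_sub {V : Type*} [NormedAddCommGroup V] [InnerProductSpace ℝ V]
    {a b : V} (ha : a ≠ 0) (hb : b ≠ 0) :
    inner ℝ (‖a‖⁻¹ • a) (a - b) - inner ℝ (‖b‖⁻¹ • b) (a - b)
      = (‖a‖⁻¹ + ‖b‖⁻¹) * (‖a‖ * ‖b‖ - inner ℝ a b) := by
  have ha' : ‖a‖ ≠ 0 := norm_ne_zero_iff.2 ha
  have hb' : ‖b‖ ≠ 0 := norm_ne_zero_iff.2 hb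
  rw [real_inner_smul_left, real_inner_smul_left, inner_sub_right, inner_sub_right,
    real_inner_self_eq_norm_sq, real_inner_self_eq_norm_sq, real_inner_comm a b]
  field_simp
  ring

variable {m : ℕ} {Ω S : Set (EuclideanSpace ℝ (Fin m))}

/-- Null measurability is the natural assumption: singular sets come from gradients that are only
a.e. strongly measurable. -/
lemma setIntegral_add_setIntegral_diff (hSΩ : S ⊆ Ω)
    (hS : NullMeasurableSet S (volume.restrict Ω)) {A B : EuclideanSpace ℝ (Fin m) → ℝ}
    (hA : IntegrableOn A Ω) (hB : IntegrableOn B Ω) :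
    (∫ x in S, A x) + ∫ x in Ω \ S, B x = ∫ x in Ω, (S.indicator A x + Sᶜ.indicator B x) := by
  rw [integral_add (hA.indicator₀ hS) (hB.indicator₀ hS.compl), integral_indicator₀ hS,
    integral_indicator₀ hS.compl, Measure.restrict_restrict₀ hS,
    Measure.restrict_restrict₀ hS.compl, Set.inter_eq_left.2 hSΩ, Set.sdiff_eq, Set.inter_comm]

variable {F : EuclideanSpace ℝ (Fin m) → EuclideanSpace ℝ (Fin m)}
  {u v : EuclideanSpace ℝ (Fin m) → ℝ}

lemma VecMemW1p.memLp {q : ℝ≥0∞} (hF : VecMemW1p q Ω F) : MemLp F q (volume.restrict Ω) := by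
  have h : MemLp (fun x => ∑ i, F x i • (EuclideanSpace.single i (1 : ℝ) :
      EuclideanSpace ℝ (Fin m))) q (volume.restrict Ω) :=
    memLp_finsetSum _ fun i _ => by
      refine (hF i).1.of_le_mul (c := 1) ((hF i).1.1.smul aestronglyMeasurable_const)
        (Eventually.of_forall fun x => ?_)
      rw [norm_smul]
      simp
  refine (memLp_congr_ae (Eventually.of_forall fun x => ?_)).1 h
  ext j
  simp [Pi.single_apply]

lemma nullMeasurableSet_singSet
    (hα : AEStronglyMeasurable (fun x => weakGrad Ω u x + F x) (volume.restrict Ω))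
    (hΩ : MeasurableSet Ω) : NullMeasurableSet (singSet Ω F u) (volume.restrict Ω) :=
  hΩ.nullMeasurableSet.inter (hα.nullMeasurableSet_eq_fun aestronglyMeasurable_const)

lemma integrableOn_inner_normalN
    (hα : AEStronglyMeasurable (fun x => weakGrad Ω u x + F x) (volume.restrict Ω))
    {P : EuclideanSpace ℝ (Fin m) → EuclideanSpace ℝ (Fin m)} (hP : IntegrableOn P Ω) :
    IntegrableOn (fun x => inner ℝ (normalN Ω F u x) (P x)) Ω := by
  have hN : AEStronglyMeasurable (normalN Ω F u) (volume.restrict Ω) :=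
    (hα.norm.aemeasurable.inv.aestronglyMeasurable).smul hα
  refine Integrable.mono hP (hN.inner hP.1) (Eventually.of_forall fun x => ?_)
  refine (norm_inner_le_norm _ _).trans (mul_le_of_le_one_left (norm_nonneg _) ?_)
  rw [normalN, norm_smul, norm_inv, norm_norm]
  exact inv_mul_le_one

/-- Equality in the weak inequality tested with `(u - v)⁺` forces `∇u + F` and `∇v + F` to be
parallel where `u > v`. -/
lemma ae_parallel_of_divNGe (hΩ : IsOpen Ω) (hF : VecMemW1p 2 Ω F) (hu : MemW1p 2 Ω u)
    (hv : MemW1p 2 Ω v) (hN : DivNGe Ω F u v) (hbd : LeOnBoundary Ω u v)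
    (hP0 : ∀ᵐ x ∂(volume.restrict Ω), weakGrad Ω (fun x => max (u x - v x) 0) x
      = (if 0 < u x - v x then (1 : ℝ) else 0) • (weakGrad Ω u x - weakGrad Ω v x)) :
    ∀ᵐ x ∂(volume.restrict Ω), 0 < u x - v x →
      ‖weakGrad Ω v x + F x‖ • (weakGrad Ω u x + F x)
        = ‖weakGrad Ω u x + F x‖ • (weakGrad Ω v x + F x) := by
  have hα : AEStronglyMeasurable (fun x => weakGrad Ω u x + F x) (volume.restrict Ω) :=
    (hu.weakGrad_memLp hΩ).1.add hF.memLp.1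
  have hβ : AEStronglyMeasurable (fun x => weakGrad Ω v x + F x) (volume.restrict Ω) :=
    (hv.weakGrad_memLp hΩ).1.add hF.memLp.1
  have h := hN _ hbd (Eventually.of_forall fun x => le_max_right _ _)
  set P := weakGrad Ω (fun x => max (u x - v x) 0) with hPdef
  have hP : IntegrableOn P Ω := memLp_one_iff_integrable.1 (hbd.1.weakGrad_memLp hΩ)
  have hSu := nullMeasurableSet_singSet hα hΩ.measurableSet
  have hSv := nullMeasurableSet_singSet hβ hΩ.measurableSet
  have hIu := integrableOn_inner_normalN hα hP
  have hIv := integrableOn_inner_normalN hβ hP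
  have hPn : IntegrableOn (fun x => ‖P x‖) Ω := hP.norm
  have hPm : IntegrableOn (fun x => -‖P x‖) Ω := hPn.neg
  rw [← integral_neg, setIntegral_add_setIntegral_diff (fun x hx => hx.1) hSu hPm hIu,
    setIntegral_add_setIntegral_diff (fun x hx => hx.1) hSv hPn hIv] at h
  set L := fun x => (singSet Ω F u).indicator (fun x => -‖P x‖) x
    + (singSet Ω F u)ᶜ.indicator (fun x => inner ℝ (normalN Ω F u x) (P x)) x with hL
  set R := fun x => (singSet Ω F v).indicator (fun x => ‖P x‖) x
    + (singSet Ω F v)ᶜ.indicator (fun x => inner ℝ (normalN Ω F v x) (P x)) x with hR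
  have hLi : Integrable L (volume.restrict Ω) := (hPm.indicator₀ hSu).add (hIu.indicator₀ hSu.compl)
  have hRi : Integrable R (volume.restrict Ω) := (hPn.indicator₀ hSv).add (hIv.indicator₀ hSv.compl)
  -- The weak inequality says ∫ L ≤ ∫ R, so the pointwise bound R ≤ L forces equality a.e. If a or b
  -- is zero then R = L automatically and the parallelism is trivial; otherwise equality is the
  -- equality case of Cauchy–Schwarz.
  have hpt : ∀ᵐ x ∂(volume.restrict Ω), R x ≤ L x ∧ (R x = L x → 0 < u x - v x →
      ‖weakGrad Ω v x + F x‖ • (weakGrad Ω u x + F x)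
        = ‖weakGrad Ω u x + F x‖ • (weakGrad Ω v x + F x)) := by
    filter_upwards [hP0, ae_restrict_mem hΩ.measurableSet] with x hx hxΩ
    have memu : x ∈ singSet Ω F u ↔ weakGrad Ω u x + F x = 0 := and_iff_right hxΩ
    have memv : x ∈ singSet Ω F v ↔ weakGrad Ω v x + F x = 0 := and_iff_right hxΩ
    by_cases hw : 0 < u x - v x
    · rw [if_pos hw, one_smul, ← add_sub_add_right_eq_sub _ _ (F x)] at hx
      simp only [hL, hR, normalN, Set.indicator, memu, memv, Set.mem_compl_iff, hx]
      generalize weakGrad Ω u x + F x = a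
      generalize weakGrad Ω v x + F x = b
      by_cases ha : a = 0
      · by_cases hb : b = 0
        · simp [ha, hb]
        · have hb' : ‖b‖ ≠ 0 := norm_ne_zero_iff.2 hb
          have : inner ℝ (‖b‖⁻¹ • b) b = ‖b‖ := by
            rw [real_inner_smul_left, real_inner_self_eq_norm_sq]
            field_simp
          simp [ha, hb, this]
      · by_cases hb : b = 0
        · have ha' : ‖a‖ ≠ 0 := norm_ne_zero_iff.2 ha
          have : inner ℝ (‖a‖⁻¹ • a) a = ‖a‖ := by
            rw [real_inner_smul_left, real_inner_self_eq_norm_sq]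
            field_simp
          simp [ha, hb, this]
        · have h1 := inner_normalized_self_sub ha hb
          have h2 := real_inner_le_norm a b
          have ha' : 0 < ‖a‖ := norm_pos_iff.2 ha
          have hb' : 0 < ‖b‖ := norm_pos_iff.2 hb
          have h3 : 0 < ‖a‖⁻¹ + ‖b‖⁻¹ := by positivity
          simp only [ha, hb, if_false, not_false_eq_true, if_true, zero_add]
          refine ⟨?_, fun h4 _ => ?_⟩
          · rw [← sub_nonneg, h1]
            exact mul_nonneg h3.le (sub_nonneg.2 h2)
          · rw [h4, sub_self] at h1
            have h5 := (mul_eq_zero.1 h1.symm).resolve_left h3.ne'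
            exact inner_eq_norm_mul_iff_real.1 (sub_eq_zero.1 h5).symm
    · rw [if_neg hw, zero_smul] at hx
      refine ⟨le_of_eq ?_, fun _ h => absurd h hw⟩
      simp [hL, hR, Set.indicator, hx]
  have hle : R ≤ᵐ[volume.restrict Ω] L := hpt.mono fun x hx => hx.1
  have heq := (integral_eq_iff_of_ae_le hRi hLi hle).1
    (le_antisymm (integral_mono_ae hRi hLi hle) h)
  filter_upwards [hpt, heq] with x hx hx2
  exact hx.2 hx2

end Comparison

/-! ### The gradient of (u - v)⁺ and the conclusion. -/

section Main

variable {m : ℕ} {Ω : Set (EuclideanSpace ℝ (Fin m))} {u v : EuclideanSpace ℝ (Fin m) → ℝ}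

lemma MemW1p.const_mul {q : ℝ≥0∞} (hu : MemW1p q Ω u) (c : ℝ) : MemW1p q Ω (fun x => c * u x) := by
  obtain ⟨h1, g, hg, hgL⟩ := hu
  refine ⟨h1.const_mul c, fun x => c • g x, ⟨hg.1.smul c, hg.2.1.smul c, fun φ hφ i => ?_⟩,
    hgL.const_smul c⟩
  have := hg.2.2 φ hφ i
  simp only [PiLp.smul_apply, smul_eq_mul, mul_assoc, integral_const_mul]
  rw [this, mul_neg]

/-- Besides locating ∇(u - v)⁺, this upgrades it from L¹ to L², as it is bounded by |∇u - ∇v|. -/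
lemma weakGrad_posPart_sub_ae_eq (hΩ : IsOpen Ω) (hu : MemW1p 2 Ω u) (hv : MemW1p 2 Ω v)
    (hw : MemW1p 1 Ω (fun x => max (u x - v x) 0)) :
    ∀ᵐ x ∂(volume.restrict Ω), weakGrad Ω (fun x => max (u x - v x) 0) x
      = (if 0 < u x - v x then (1 : ℝ) else 0) • (weakGrad Ω u x - weakGrad Ω v x) :=
  ae_eq_of_apply fun i => (hw.isWeakGrad.isWeakPartial i).ae_eq hΩ
    (((hu.isWeakGrad.isWeakPartial i).sub (hv.isWeakGrad.isWeakPartial i)).posPart hΩ)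

end Main

end HeisenbergGraph

open HeisenbergGraph in
theorem theoremC (n : ℕ) (Ω : Set (EuclideanSpace ℝ (Fin (2 * n))))
    (hΩ_open : IsOpen Ω) (hΩ_conn : IsConnected Ω) (hΩ_bdd : Bornology.IsBounded Ω)
    (F : EuclideanSpace ℝ (Fin (2 * n)) → EuclideanSpace ℝ (Fin (2 * n)))
    (hF : HeisenbergGraph.VecMemW1p 2 Ω F)
    (hdiv : ∀ᵐ x ∂(volume.restrict Ω),
      0 < HeisenbergGraph.weakDiv Ω (fun y => HeisenbergGraph.starVec (F y)) x)
    (u v : EuclideanSpace ℝ (Fin (2 * n)) → ℝ)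
    (hu : HeisenbergGraph.MemW1p 2 Ω u) (hv : HeisenbergGraph.MemW1p 2 Ω v)
    (hN : HeisenbergGraph.DivNGe Ω F u v)
    (hbd : HeisenbergGraph.LeOnBoundary Ω u v) :
    ∀ᵐ x ∂(volume.restrict Ω), u x ≤ v x := by
  have hP := weakGrad_posPart_sub_ae_eq hΩ_open hu hv hbd.1
  have hpar := ae_parallel_of_divNGe hΩ_open hF hu hv hN hbd hP
  set w : EuclideanSpace ℝ (Fin (2 * n)) → ℝ := fun x => max (u x - v x) 0 with hw
  set P := weakGrad Ω w with hPdef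
  have hw1 : MemW1p0 1 Ω w := hbd
  have hdarctan : ∀ s, |deriv Real.arctan s| ≤ 1 := fun s => by
    rw [Real.deriv_arctan, abs_of_nonneg (by positivity)]
    exact div_le_one_of_le₀ (by nlinarith [sq_nonneg s]) (by positivity)
  -- arctan is smooth and bounded with bounded derivative, and it vanishes only at 0, so f = 0 still
  -- implies w = 0.
  have hf := hw1.isBoundedTestLimit_comp hΩ_open (h := Real.arctan) Real.contDiff_arctan
    Real.arctan_zero (C := Real.pi / 2)
    (fun s => abs_le.2 ⟨(Real.neg_pi_div_two_lt_arctan _).le, (Real.arctan_lt_pi_div_two _).le⟩)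
    hdarctan
  set f : EuclideanSpace ℝ (Fin (2 * n)) → ℝ := fun x => Real.arctan (w x) with hfdef
  set p : EuclideanSpace ℝ (Fin (2 * n)) → EuclideanSpace ℝ (Fin (2 * n)) :=
    fun x => deriv Real.arctan (w x) • P x with hpdef
  have hpm : ∀ i, AEStronglyMeasurable (fun x => p x i) (volume.restrict Ω) := fun i => (hf.1 i).1
  have hUL := hu.weakGrad_memLp hΩ_open
  have hVL := hv.weakGrad_memLp hΩ_open
  have hpL : ∀ i, MemLp (fun x => p x i) 2 (volume.restrict Ω) := fun i => by
    refine (memLp_apply (hUL.sub hVL) i).of_le (hpm i) ?_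
    filter_upwards [hP] with x hx
    simp only [hpdef, hx, PiLp.smul_apply, smul_eq_mul, norm_mul]
    refine (mul_le_of_le_one_left (by positivity) (hdarctan _)).trans
      (mul_le_of_le_one_left (norm_nonneg _) ?_)
    split_ifs <;> simp
  obtain ⟨D, hD⟩ := hf.exists_bound
  obtain ⟨D2, hD2⟩ := hf.sq.exists_bound
  have hfm := hf.aestronglyMeasurable
  have hp2L : ∀ i, MemLp (fun x => ((2 * f x) • p x) i) 2 (volume.restrict Ω) := fun i => by
    refine (hpL i).of_le_mul (c := 2 * D) ((hfm.const_mul 2).mul (hpm i)) ?_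
    filter_upwards [hD] with x hx
    rw [PiLp.smul_apply, smul_eq_mul, norm_mul]
    refine mul_le_mul_of_nonneg_right ?_ (norm_nonneg _)
    rw [norm_mul]
    simpa using hx
  have hG : ∀ i, MemW1p 2 Ω (fun x => starVec (F x) i) := fun i => by
    simp only [starVec_apply]
    exact (hF _).const_mul _
  set q : Fin (2 * n) → EuclideanSpace ℝ (Fin (2 * n)) → ℝ :=
    fun i x => weakGrad Ω (fun y => starVec (F y) i) x i with hq
  have hqL : ∀ i, MemLp (q i) 2 (volume.restrict Ω) := fun i =>
    memLp_apply ((hG i).weakGrad_memLp hΩ_open) i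
  -- Integration by parts of f² against each component of F*.
  have hA := fun i => hf.sq.integral_eq_zero hΩ_open hΩ_bdd ((hG i).isWeakGrad.isWeakPartial i)
    (hp2L i) (hG i).1 (hqL i)
  -- Weak form of div (∇v)* = 0, tested with f²/2.
  have hB := sum_pairSign_mul_eq_zero (hf.integral_partial_comm hΩ_open hΩ_bdd hpL
    (fun i => hv.isWeakGrad.isWeakPartial i) (fun i => memLp_apply hVL i))
  have hZ1 : ∀ i, Integrable (fun x => f x ^ 2 * q i x) (volume.restrict Ω) := fun i =>
    (integrableOn_of_memLp_two hΩ_bdd (hqL i)).bdd_mul hf.sq.aestronglyMeasurable hD2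
  have hZ2 : ∀ i, Integrable (fun x => f x ^ 2 * q i x + starVec (F x) i * ((2 * f x) • p x) i)
      (volume.restrict Ω) := fun i => (hZ1 i).add ((hG i).1.integrable_mul (hp2L i))
  have hZ3 : ∀ i, Integrable (fun x => 2 * (pairSign i *
      (f x * (weakGrad Ω v x (pairSwap i) * p x i)))) (volume.restrict Ω) := fun i =>
    ((((memLp_apply hVL (pairSwap i)).integrable_mul (hpL i)).bdd_mul hfm hD).const_mul _).const_mul
      _
  have hZ : ∀ i, Integrable (fun x => (f x ^ 2 * q i x + starVec (F x) i * ((2 * f x) • p x) i)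
      + 2 * (pairSign i * (f x * (weakGrad Ω v x (pairSwap i) * p x i))))
      (volume.restrict Ω) := fun i => (hZ2 i).add (hZ3 i)
  have hsum : ∫ x in Ω, ∑ i, ((f x ^ 2 * q i x + starVec (F x) i * ((2 * f x) • p x) i)
      + 2 * (pairSign i * (f x * (weakGrad Ω v x (pairSwap i) * p x i)))) = 0 := by
    rw [integral_finsetSum _ fun i _ => hZ i]
    have hi : ∀ i, ∫ x in Ω, ((f x ^ 2 * q i x + starVec (F x) i * ((2 * f x) • p x) i)
        + 2 * (pairSign i * (f x * (weakGrad Ω v x (pairSwap i) * p x i))))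
        = 2 * (pairSign i * ∫ x in Ω, f x * (weakGrad Ω v x (pairSwap i) * p x i)) := fun i => by
      rw [integral_add (hZ2 i) (hZ3 i), hA i, zero_add, integral_const_mul, integral_const_mul]
    simp only [hi]
    rw [← Finset.mul_sum, hB, mul_zero]
  have hae : ∀ᵐ x ∂(volume.restrict Ω),
      ∑ i, ((f x ^ 2 * q i x + starVec (F x) i * ((2 * f x) • p x) i)
        + 2 * (pairSign i * (f x * (weakGrad Ω v x (pairSwap i) * p x i))))
      = f x ^ 2 * weakDiv Ω (fun y => starVec (F y)) x := by
    filter_upwards [hP, hpar] with x hx hx2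
    have hzero : ∑ i, P x i * starVec (weakGrad Ω v x + F x) i = 0 := by
      by_cases hpos : 0 < u x - v x
      · rw [hx, if_pos hpos, one_smul, ← add_sub_add_right_eq_sub _ _ (F x)]
        exact sum_sub_mul_starVec_eq_zero (hx2 hpos)
      · rw [hx, if_neg hpos, zero_smul]
        simp
    -- The F* and (∇v)* terms combine into ∇w · (∇v + F)*, which vanishes by parallelism where u > v
    -- and because ∇w = 0 elsewhere.
    calc _ = f x ^ 2 * ∑ i, q i x + 2 * f x * deriv Real.arctan (w x) *
          ∑ i, P x i * starVec (weakGrad Ω v x + F x) i := by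
          rw [Finset.mul_sum, Finset.mul_sum, ← Finset.sum_add_distrib]
          refine Finset.sum_congr rfl fun i _ => ?_
          simp only [hpdef, starVec_apply, PiLp.smul_apply, PiLp.add_apply, smul_eq_mul]
          ring
      _ = _ := by rw [hzero, mul_zero, add_zero]; rfl
  rw [integral_congr_ae hae] at hsum
  have hint : Integrable (fun x => f x ^ 2 * weakDiv Ω (fun y => starVec (F y)) x)
      (volume.restrict Ω) :=
    (integrable_finsetSum _ fun i _ => hZ i).congr hae
  have hnonneg : 0 ≤ᵐ[volume.restrict Ω]
      fun x => f x ^ 2 * weakDiv Ω (fun y => starVec (F y)) x :=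
    hdiv.mono fun x hx => mul_nonneg (sq_nonneg _) hx.le
  have hz := (integral_eq_zero_iff_of_nonneg_ae hnonneg hint).1 hsum
  filter_upwards [hz, hdiv] with x hx hx2
  have h1 : f x = 0 := by
    have := (mul_eq_zero.1 hx).resolve_right hx2.ne'
    exact pow_eq_zero_iff two_ne_zero |>.1 this
  have h2 : w x = 0 := Real.arctan_eq_zero_iff.1 h1
  have h3 : u x - v x ≤ 0 := (le_max_left _ _).trans h2.le
  linarith
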